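/- Let $\mathcal H$ be a complex Hilbert space, $(S_t)_{t\in\mathbb R}$ a strongly continuous one-parameter unitary group on $\mathcal H$ and $\hat n$ a bounded positive operator on $\mathcal H$ with $S_{-t}\hat nS_t=\hat n$ for all $t$. Let $A^+(f)$, $A(g)$ ($f,g\in\mathcal H$) be creation and annihilation operators with $[A(f),A^+(g)]=\langle f,g\rangle$, let $\omega_{\hat n}$ be the gauge-invariant mean-zero Gaussian state on the algebra of polynomials in them with $\omega_{\hat n}(A^+(f)A(g))=\langle g,\hat nf\rangle$, and let $N(T)$ be the second quantization of $T$, so that $N(|f\rangle\langle g|)=A^+(f)A(g)$. For $\varepsilon>0$ and $\omega\in\mathbb R$ put $$N_{T,\omega,\varepsilon}(t)=\frac{e^{-it\omega/\varepsilon}}{\varepsilon}N(S_{t/\varepsilon}TS_{-t/\varepsilon}).$$ Let $n\ge 1$, $f_l,g_l\in\mathcal H$, $T_l=|f_l\rangle\langle g_l|$, $\omega_l\in\mathbb R$ for $1\le l\le n$, and $\tilde\omega_k=\omega_k+\dots+\omega_n$. Let $W_\varepsilon(t_1,\dots,t_n)=\omega_{\varepsilon\hat n}\bigl(N_{T_1,\omega_1,\varepsilon}(t_1)\cdots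 N_{T_n,\omega_n,\varepsilon}(t_n)\bigr)$, and define the truncated functions $W^T_\varepsilon$ recursively by requiring that the correlation function of every set of indices (with the operators in increasing order of the indices) be the sum, over all partitions of that set into nonempty blocks, of the products of the truncated functions of the blocks. Let $P_E=(2\pi)^{-1}\int dt\,S_te^{-itE}$, in the sense of distributions in $E$. Assume that the distributions $E\mapsto\langle g_j,P_Ef_i\rangle$ for $j<i$ and $E\mapsto\langle g_j,P_E\hat nf_i\rangle$ for all $i,j$ are functions belonging to $L^1(\mathbb R)\cap L^n(\mathbb R)$. Then the function $\langle g_n,P_E\hat nf_1\rangle\prod_{l=2}^n\langle g_{l-1},P_{E+\tilde\omega_l}f_l\rangle$ of $E$ is integrable and, in the sense of tempered distributions in $t_1,\dots,t_n$, $$\lim_{\varepsilon\downarrow 0}W^T_\varepsilon(t_1,\dots,t_n)=(2\pi)^{n-1}\prod_{l=1}^{n-1}\delta(t_{l+1}-t_l)\;\delta_{\tilde\omega_1,0}\int dE\,\langle g_n,P_E\hat nf_1\rangle\langle g_1,P_{E+\tilde\omega_2}f_2\rangle\cdots\langle g_{n-1},P_{E+\tilde\omega_n}f_n\rangle ,$$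 where $\delta_{\tilde\omega_1,0}$ is the Kronecker symbol. Moreover, put $A^+_l=\varepsilon^{-1/2}A^+(S_{t_l/\varepsilon}f_l)$ and $A_l=\varepsilon^{-1/2}A(S_{t_l/\varepsilon}g_l)$. To every permutation $\sigma$ of $\{1,\dots,n\}$ associate the diagram that pairs $A^+_i$ with $A_{\sigma(i)}$ in the string $A^+_1A_1A^+_2A_2\cdots A^+_nA_n$. Its contribution is $e^{-i\sum_l\omega_lt_l/\varepsilon}$ times the product over the pairs of the two-point functions, in the state $\omega_{\varepsilon\hat n}$, of the two paired operators in the order of the string. The diagram is irreducible if no nonempty proper subset $I$ of $\{1,\dots,n\}$ satisfies $i\in I\Leftrightarrow\sigma(i)\in I$ for all $i$. Then $W^T_\varepsilon$ is the sum of the contributions of the irreducible diagrams. Exactly one irreducible diagram is non-crossing, namely the one consisting of the outer pair $A^+_1A_n$ and the consecutive pairs $A_lA^+_{l+1}$, $1\le l<n$. The contribution of this diagram converges, in the sense of tempered distributions, to the limit above, and the contribution of every other irreducible diagram converges to $0$. -/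

import Mathlib

open MeasureTheory Filter Topology
open scoped SchwartzMap

noncomputable section

namespace LowDensity

section Wick

variable {X : Type*}

/-- Wick's formula: the value on the word `x₁ x₂ ⋯ xₘ` of the mean-zero Gaussian functional with
two-point function `c x y = ω(x y)`, i.e. the sum over all pairings of the letters of the products
of the two-point functions, the letters of every pair being kept in the order of the word.
It is organised by the partner of the first letter. -/
def wick (c : X → X → ℂ) : List X → ℂ
  | [] => 1
  | x :: l => ∑ k : Fin l.length, c x l[k] * wick c (l.eraseIdx k)
  termination_by l => l.length
  decreasing_by
    have := List.length_eraseIdx_of_lt k.isLt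
    simp only [List.length_cons]
    omega

/-- Sum of `F (letter) (remaining word)` over the letters of a word. -/
def pick (F : X → List X → ℂ) : List X → ℂ
  | [] => 0
  | a :: l => F a l + pick (fun b r => F b (a :: r)) l

theorem sum_eq_pick (F : X → List X → ℂ) (l : List X) :
    ∑ k : Fin l.length, F l[k] (l.eraseIdx k) = pick F l := by
  induction l generalizing F with
  | nil => simp [pick]
  | cons a l ih =>
    rw [pick, ← ih]
    exact Fin.sum_univ_succ (n := l.length)
      (fun k : Fin (l.length + 1) => F ((a :: l)[(k : ℕ)]) ((a :: l).eraseIdx k))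

theorem wick_nil (c : X → X → ℂ) : wick c [] = 1 := by rw [wick]

theorem wick_cons (c : X → X → ℂ) (x : X) (l : List X) :
    wick c (x :: l) = pick (fun b r => c x b * wick c r) l := by
  rw [wick, ← sum_eq_pick (fun b r => c x b * wick c r)]

theorem pick_append (F : X → List X → ℂ) (u v : List X) :
    pick F (u ++ v) =
      pick (fun b r => F b (r ++ v)) u + pick (fun b r => F b (u ++ r)) v := by
  induction u generalizing F with
  | nil => simp [pick]
  | cons a u ih => simp [pick, ih, add_assoc]

theorem pick_add (F G : X → List X → ℂ) (l : List X) :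
    pick (fun b r => F b r + G b r) l = pick F l + pick G l := by
  induction l generalizing F G with
  | nil => simp [pick]
  | cons a l ih => simp only [pick, ih]; ring

theorem pick_smul (s : ℂ) (F : X → List X → ℂ) (l : List X) :
    pick (fun b r => s * F b r) l = s * pick F l := by
  induction l generalizing F with
  | nil => simp [pick]
  | cons a l ih => simp only [pick, ih]; ring

/-- Only words shorter than the given one by one letter matter. -/
theorem pick_congr {F G : X → List X → ℂ} (l : List X)
    (h : ∀ b r, r.length + 1 = l.length → F b r = G b r) : pick F l = pick G l := by
  induction l generalizing F G with
  | nil => simp [pick]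
  | cons a l ih =>
    rw [pick, pick, h a l (by simp)]
    congr 1
    exact ih fun b r hr => h b (a :: r) (by simp [hr])

theorem pick_pick_swap (G : X → X → List X → ℂ) (l : List X) :
    pick (fun b r => pick (fun b' r' => G b b' r') r) l =
      pick (fun b r => pick (fun b' r' => G b' b r') r) l := by
  induction l generalizing G with
  | nil => simp [pick]
  | cons a l ih =>
    simp only [pick, pick_add]
    rw [ih (fun b b' r => G b b' (a :: r))]
    ring

theorem wick_linear (c : X → X → ℂ) (x y z : X) (s t : ℂ)
    (h1 : ∀ w, c x w = s * c y w + t * c z w) (h2 : ∀ w, c w x = s * c w y + t * c w z)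
    (u v : List X) :
    wick c (u ++ x :: v) = s * wick c (u ++ y :: v) + t * wick c (u ++ z :: v) := by
  induction hn : u.length + v.length using Nat.strong_induction_on generalizing u v with
  | _ n ih =>
    subst hn
    cases u with
    | nil =>
      simp only [List.nil_append, wick_cons]
      rw [← pick_smul, ← pick_smul, ← pick_add]
      refine pick_congr _ fun b r _ => ?_
      rw [h1]; ring
    | cons a u =>
      simp only [List.cons_append, wick_cons, pick_append, pick, mul_add, ← pick_smul]
      have e1 : pick (fun b r => c a b * wick c (r ++ x :: v)) u
          = pick (fun b r => s * (c a b * wick c (r ++ y :: v))) u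
            + pick (fun b r => t * (c a b * wick c (r ++ z :: v))) u := by
        rw [← pick_add]
        refine pick_congr _ fun b r hr => ?_
        rw [ih _ (by simp; omega) r v rfl]; ring
      have e2 : pick (fun b r => c a b * wick c (u ++ x :: r)) v
          = pick (fun b r => s * (c a b * wick c (u ++ y :: r))) v
            + pick (fun b r => t * (c a b * wick c (u ++ z :: r))) v := by
        rw [← pick_add]
        refine pick_congr _ fun b r hr => ?_
        rw [ih _ (by simp; omega) u r rfl]; ring
      rw [e1, e2, h2]; ring

theorem wick_swap (c : X → X → ℂ) (x y : X) (d : ℂ) (hd : c x y = c y x + d)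
    (u v : List X) :
    wick c (u ++ x :: y :: v) = wick c (u ++ y :: x :: v) + d * wick c (u ++ v) := by
  induction hn : u.length + v.length using Nat.strong_induction_on generalizing u v with
  | _ n ih =>
    subst hn
    cases u with
    | nil =>
      simp only [List.nil_append, wick_cons, pick, ← pick_smul]
      have := pick_pick_swap (fun b b' r => c x b * (c y b' * wick c r)) v
      rw [this, hd]
      have e : pick (fun b r => pick (fun b' r' => c x b' * (c y b * wick c r')) r) v
          = pick (fun b r => pick (fun b' r' => c y b * (c x b' * wick c r')) r) v := by
        refine pick_congr _ fun b r _ => pick_congr _ fun b' r' _ => by ring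
      rw [e]; ring
    | cons a u =>
      simp only [List.cons_append, wick_cons, pick_append, pick, mul_add, ← pick_smul]
      have e1 : pick (fun b r => c a b * wick c (r ++ x :: y :: v)) u
          = pick (fun b r => c a b * wick c (r ++ y :: x :: v)) u
            + pick (fun b r => d * (c a b * wick c (r ++ v))) u := by
        rw [← pick_add]
        refine pick_congr _ fun b r hr => ?_
        rw [ih _ (by simp; omega) r v rfl]; ring
      have e2 : pick (fun b r => c a b * wick c (u ++ x :: y :: r)) v
          = pick (fun b r => c a b * wick c (u ++ y :: x :: r)) v
            + pick (fun b r => d * (c a b * wick c (u ++ r))) v := by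
        rw [← pick_add]
        refine pick_congr _ fun b r hr => ?_
        rw [ih _ (by simp; omega) u r rfl]; ring
      rw [e1, e2]; ring

/-- Left multiplication of words by elements of the free algebra. -/
def wordAct (X : Type*) : FreeAlgebra ℂ X →ₐ[ℂ] Module.End ℂ (List X →₀ ℂ) :=
  FreeAlgebra.lift ℂ fun x => Finsupp.lmapDomain ℂ ℂ (List.cons x)

/-- The linear functional on the free algebra given on words by Wick's formula. -/
def wickFree (c : X → X → ℂ) : FreeAlgebra ℂ X →ₗ[ℂ] ℂ :=
  (Finsupp.linearCombination ℂ (wick c)) ∘ₗ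
    (LinearMap.applyₗ (Finsupp.single [] 1)) ∘ₗ (wordAct X).toLinearMap

/-- The word `x₁ ⋯ xₘ` as an element of the free algebra. -/
def word (l : List X) : FreeAlgebra ℂ X := (l.map (FreeAlgebra.ι ℂ)).prod

theorem wordAct_word (l m : List X) :
    wordAct X (word l) (Finsupp.single m 1) = Finsupp.single (l ++ m) 1 := by
  induction l with
  | nil => simp [word]
  | cons a l ih =>
    have : word (a :: l) = FreeAlgebra.ι ℂ a * word l := by simp [word]
    rw [this, map_mul, Module.End.mul_apply, ih]
    simp [wordAct, Finsupp.lmapDomain_apply, Finsupp.mapDomain_single]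

theorem wickFree_word (c : X → X → ℂ) (l : List X) : wickFree c (word l) = wick c l := by
  simp [wickFree, wordAct_word]

theorem span_word : Submodule.span ℂ (Set.range (word (X := X))) = ⊤ := by
  rw [eq_top_iff]
  rintro a -
  have hmul : ∀ a ∈ Submodule.span ℂ (Set.range (word (X := X))),
      ∀ b ∈ Submodule.span ℂ (Set.range (word (X := X))),
      a * b ∈ Submodule.span ℂ (Set.range (word (X := X))) := by
    intro a ha b hb
    refine Submodule.span_induction₂ (p := fun a b _ _ =>
      a * b ∈ Submodule.span ℂ (Set.range (word (X := X)))) ?_ ?_ ?_ ?_ ?_ ?_ ?_ ha hb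
    · rintro _ _ ⟨l, rfl⟩ ⟨m, rfl⟩
      exact Submodule.subset_span ⟨l ++ m, by simp [word]⟩
    · intro y _; simp
    · intro y _; simp
    · intro x y z _ _ _ h1 h2; rw [add_mul]; exact Submodule.add_mem _ h1 h2
    · intro x y z _ _ _ h1 h2; rw [mul_add]; exact Submodule.add_mem _ h1 h2
    · intro r x y _ _ h; rw [smul_mul_assoc]; exact Submodule.smul_mem _ _ h
    · intro r x y _ _ h; rw [mul_smul_comm]; exact Submodule.smul_mem _ _ h
  refine FreeAlgebra.induction ℂ X (motive := fun a =>
    a ∈ Submodule.span ℂ (Set.range (word (X := X)))) ?_ ?_ ?_ ?_ a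
  · intro r
    rw [Algebra.algebraMap_eq_smul_one]
    exact Submodule.smul_mem _ _ (Submodule.subset_span ⟨[], by simp [word]⟩)
  · intro x; exact Submodule.subset_span ⟨[x], by simp [word]⟩
  · intro a b ha hb; exact hmul a ha b hb
  · intro a b ha hb; exact Submodule.add_mem _ ha hb

theorem wickFree_congr (c : X → X → ℂ) (p q : FreeAlgebra ℂ X)
    (h : ∀ u v : List X, wickFree c (word u * p * word v) = wickFree c (word u * q * word v))
    (a b : FreeAlgebra ℂ X) : wickFree c (a * p * b) = wickFree c (a * q * b) := by
  have ha : a ∈ Submodule.span ℂ (Set.range (word (X := X))) := by rw [span_word]; trivial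
  have hb : b ∈ Submodule.span ℂ (Set.range (word (X := X))) := by rw [span_word]; trivial
  refine Submodule.span_induction₂ (p := fun a b _ _ =>
    wickFree c (a * p * b) = wickFree c (a * q * b)) ?_ ?_ ?_ ?_ ?_ ?_ ?_ ha hb
  · rintro _ _ ⟨l, rfl⟩ ⟨m, rfl⟩; exact h l m
  · intro y _; simp
  · intro y _; simp
  · intro x y z _ _ _ h1 h2; simp only [add_mul, map_add, h1, h2]
  · intro x y z _ _ _ h1 h2; simp only [mul_add, map_add, h1, h2]
  · intro r x y _ _ h; simp only [smul_mul_assoc, map_smul, h]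
  · intro r x y _ _ h; simp only [mul_smul_comm, map_smul, h]

/-- A linear functional on a free algebra which is compatible with a relation descends to the
quotient by the relation. -/
theorem exists_descent {A : Type*} [Ring A] [Algebra ℂ A] (r : A → A → Prop) (W : A →ₗ[ℂ] ℂ)
    (h : ∀ p q, r p q → ∀ a b, W (a * p * b) = W (a * q * b)) :
    ∃ V : RingQuot r →ₗ[ℂ] ℂ, ∀ a, V (RingQuot.mkAlgHom ℂ r a) = W a := by
  obtain ⟨K, hK⟩ : ∃ K : Submodule A A, ∀ a, a ∈ K ↔ ∀ x, W (x * a) = 0 :=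
    ⟨{ carrier := {a | ∀ x, W (x * a) = 0}
       add_mem' := fun {a b} ha hb x => by
        rw [mul_add, map_add, ha x, hb x, add_zero]
       zero_mem' := fun x => by rw [mul_zero, map_zero]
       smul_mem' := fun s a ha x => by
        rw [smul_eq_mul, ← mul_assoc]; exact ha _ }, fun a => Iff.rfl⟩
  have hL : ∀ ⦃p q⦄, r p q →
      Algebra.lsmul ℂ ℂ (A ⧸ K) p = Algebra.lsmul ℂ ℂ (A ⧸ K) q := by
    intro p q hpq
    refine LinearMap.ext fun z => ?_
    obtain ⟨b, rfl⟩ := Submodule.Quotient.mk_surjective K z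
    change (Submodule.Quotient.mk (p • b) : A ⧸ K) = Submodule.Quotient.mk (q • b)
    rw [Submodule.Quotient.eq, hK]
    intro x
    have := h p q hpq x b
    rw [smul_eq_mul, smul_eq_mul, mul_sub, map_sub, ← mul_assoc, ← mul_assoc, this, sub_self]
  have hW : K.restrictScalars ℂ ≤ LinearMap.ker W := by
    intro a ha
    have := (hK a).1 ha 1
    rwa [one_mul] at this
  refine ⟨(K.restrictScalars ℂ).liftQ W hW ∘ₗ
    (Submodule.Quotient.restrictScalarsEquiv ℂ K).symm.toLinearMap ∘ₗ
    LinearMap.applyₗ (Submodule.Quotient.mk 1) ∘ₗ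
    (RingQuot.liftAlgHom ℂ ⟨Algebra.lsmul ℂ ℂ (A ⧸ K), hL⟩).toLinearMap, fun a => ?_⟩
  rw [LinearMap.comp_apply, LinearMap.comp_apply, LinearMap.comp_apply,
    AlgHom.toLinearMap_apply, RingQuot.liftAlgHom_mkAlgHom_apply, LinearMap.applyₗ_apply_apply]
  change W (a • (1 : A)) = W a
  rw [smul_eq_mul, mul_one]

end Wick

section CCR

set_option linter.unusedSimpArgs false
set_option linter.unusedTactic false
set_option linter.unreachableTactic false
set_option linter.unnecessarySeqFocus false

variable (H : Type*) [NormedAddCommGroup H] [InnerProductSpace ℂ H]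

/-- The generators of the CCR algebra: `create f` stands for `A⁺(f)` and `annihilate g` for
`A⁻(g) = A(g)`. -/
inductive Ladder : Type _
  | create (f : H) : Ladder
  | annihilate (g : H) : Ladder

variable {H}

/-- `A⁺(f)` in the free algebra. -/
abbrev freeCr (f : H) : FreeAlgebra ℂ (Ladder H) := FreeAlgebra.ι ℂ (Ladder.create f)

/-- `A(g)` in the free algebra. -/
abbrev freeAn (g : H) : FreeAlgebra ℂ (Ladder H) := FreeAlgebra.ι ℂ (Ladder.annihilate g)

/-- The defining relations: `A⁺` is linear, `A` is conjugate linear, and the canonical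
commutation relations hold, `[A(f), A⁺(g)] = ⟨f, g⟩`, all other commutators being zero. -/
inductive CCRRel : FreeAlgebra ℂ (Ladder H) → FreeAlgebra ℂ (Ladder H) → Prop
  | create_add (f g : H) : CCRRel (freeCr (f + g)) (freeCr f + freeCr g)
  | create_smul (z : ℂ) (f : H) : CCRRel (freeCr (z • f)) (z • freeCr f)
  | annihilate_add (f g : H) : CCRRel (freeAn (f + g)) (freeAn f + freeAn g)
  | annihilate_smul (z : ℂ) (f : H) : CCRRel (freeAn (z • f)) (starRingEnd ℂ z • freeAn f)
  | create_comm (f g : H) : CCRRel (freeCr f * freeCr g) (freeCr g * freeCr f)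
  | annihilate_comm (f g : H) : CCRRel (freeAn f * freeAn g) (freeAn g * freeAn f)
  | ccr (f g : H) : CCRRel (freeAn f * freeCr g) (freeCr g * freeAn f + algebraMap ℂ _ (inner ℂ f g))

variable (H) in
/-- The algebra of polynomials in the creation and annihilation operators over `H`. -/
abbrev CCRAlgebra : Type _ := RingQuot (CCRRel (H := H))

/-- A generator as an element of the CCR algebra. -/
def ladderOp (x : Ladder H) : CCRAlgebra H :=
  RingQuot.mkAlgHom ℂ CCRRel (FreeAlgebra.ι ℂ x)

/-- The creation operator `A⁺(f)`. -/
def creation (f : H) : CCRAlgebra H := ladderOp (Ladder.create f)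

/-- The annihilation operator `A(g)`. -/
def annihilation (g : H) : CCRAlgebra H := ladderOp (Ladder.annihilate g)

/-- The gauge-invariant two-point function with density operator `n`:
`ω(A⁺(f) A(g)) = ⟨g, n f⟩` and `ω(A(g) A⁺(f)) = ⟨g, f⟩ + ⟨g, n f⟩`. -/
def twoPoint (n : H →L[ℂ] H) : Ladder H → Ladder H → ℂ
  | .create f, .annihilate g => inner ℂ g (n f)
  | .annihilate g, .create f => inner ℂ g f + inner ℂ g (n f)
  | .create _, .create _ => 0
  | .annihilate _, .annihilate _ => 0

/-- Wick's formula with this two-point function is compatible with the relations of the CCR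
algebra, so that the Gaussian functional exists. -/
theorem exists_gaussianState (n : H →L[ℂ] H) :
    ∃ ω : CCRAlgebra H →ₗ[ℂ] ℂ,
      ∀ l : List (Ladder H), ω (l.map ladderOp).prod = wick (twoPoint n) l := by
  obtain ⟨V, hV⟩ := exists_descent (CCRRel (H := H)) (wickFree (twoPoint n)) (by
    have w3 : ∀ (u v : List (Ladder H)) (x : Ladder H),
        word u * FreeAlgebra.ι ℂ x * word v = word (u ++ x :: v) := by
      intro u v x; simp [word, mul_assoc]
    have w4 : ∀ (u v : List (Ladder H)) (x y : Ladder H),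
        word u * (FreeAlgebra.ι ℂ x * FreeAlgebra.ι ℂ y) * word v
          = word (u ++ x :: y :: v) := by
      intro u v x y; simp [word, mul_assoc]
    have w5 : ∀ (u v : List (Ladder H)), word u * word v = word (u ++ v) := by
      intro u v; simp [word]
    intro p q hpq
    refine wickFree_congr _ _ _ fun u v => ?_
    cases hpq with
    | create_add f g =>
      simp only [mul_add, add_mul, map_add, w3, wickFree_word]
      rw [wick_linear (twoPoint n) (.create (f + g)) (.create f) (.create g) 1 1]
      · ring
      · rintro (w | w) <;> simp [twoPoint, inner_add_right] <;> ring
      · rintro (w | w) <;> simp [twoPoint, inner_add_right] <;> ring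
    | create_smul z f =>
      simp only [mul_smul_comm, smul_mul_assoc, map_smul, w3, wickFree_word]
      rw [wick_linear (twoPoint n) (.create (z • f)) (.create f) (.create f) z 0]
      · simp
      · rintro (w | w) <;> simp [twoPoint, inner_smul_right] <;> ring
      · rintro (w | w) <;> simp [twoPoint, inner_smul_right] <;> ring
    | annihilate_add f g =>
      simp only [mul_add, add_mul, map_add, w3, wickFree_word]
      rw [wick_linear (twoPoint n) (.annihilate (f + g)) (.annihilate f) (.annihilate g) 1 1]
      · ring
      · rintro (w | w) <;> simp [twoPoint, inner_add_left] <;> ring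
      · rintro (w | w) <;> simp [twoPoint, inner_add_left] <;> ring
    | annihilate_smul z f =>
      simp only [mul_smul_comm, smul_mul_assoc, map_smul, w3, wickFree_word]
      rw [wick_linear (twoPoint n) (.annihilate (z • f)) (.annihilate f) (.annihilate f)
        (starRingEnd ℂ z) 0]
      · simp
      · rintro (w | w) <;> simp [twoPoint, inner_smul_left] <;> ring
      · rintro (w | w) <;> simp [twoPoint, inner_smul_left] <;> ring
    | create_comm f g =>
      simp only [w4, wickFree_word]
      rw [wick_swap (twoPoint n) _ _ 0 (by simp [twoPoint])]
      simp
    | annihilate_comm f g =>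
      simp only [w4, wickFree_word]
      rw [wick_swap (twoPoint n) _ _ 0 (by simp [twoPoint])]
      simp
    | ccr f g =>
      simp only [mul_add, add_mul, map_add, w4, wickFree_word]
      rw [wick_swap (twoPoint n) _ _ (inner ℂ f g) (by simp [twoPoint]; ring)]
      rw [Algebra.algebraMap_eq_smul_one]
      simp [w5, wickFree_word])
  refine ⟨V, fun l => ?_⟩
  have : (l.map ladderOp).prod = RingQuot.mkAlgHom ℂ CCRRel (word l) := by
    rw [word, map_list_prod, List.map_map]; rfl
  rw [this, hV, wickFree_word]

/-- The gauge-invariant mean-zero Gaussian state `ω_n` on the CCR algebra, with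
`ω_n(A⁺(f) A(g)) = ⟨g, n f⟩`. -/
def gaussianState (n : H →L[ℂ] H) : CCRAlgebra H →ₗ[ℂ] ℂ :=
  (exists_gaussianState n).choose

theorem gaussianState_prod (n : H →L[ℂ] H) (l : List (Ladder H)) :
    gaussianState n (l.map ladderOp).prod = wick (twoPoint n) l :=
  (exists_gaussianState n).choose_spec l

theorem creation_add (f g : H) : creation (f + g) = creation f + creation g := by
  simpa [creation, ladderOp] using RingQuot.mkAlgHom_rel ℂ (CCRRel.create_add f g)

theorem creation_smul (z : ℂ) (f : H) : creation (z • f) = z • creation f := by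
  simpa [creation, ladderOp] using RingQuot.mkAlgHom_rel ℂ (CCRRel.create_smul z f)

theorem annihilation_smul (z : ℂ) (f : H) :
    annihilation (z • f) = starRingEnd ℂ z • annihilation f := by
  simpa [annihilation, ladderOp] using RingQuot.mkAlgHom_rel ℂ (CCRRel.annihilate_smul z f)

end CCR

section Model

variable {H : Type*} [NormedAddCommGroup H] [InnerProductSpace ℂ H] [CompleteSpace H]

open Classical in
/-- The second quantization `N(T) = dΓ(T)` of an operator `T` of finite rank, as a polynomial in
the creation and annihilation operators: `T = ∑ₖ |eₖ⟩⟨T* eₖ|` for an orthonormal basis `e` of the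
range of `T`, hence `N(T) = ∑ₖ A⁺(eₖ) A(T* eₖ)`. -/
def numberOp (T : H →L[ℂ] H) : CCRAlgebra H :=
  if _h : FiniteDimensional ℂ (LinearMap.range (T : H →ₗ[ℂ] H)) then
    ∑ k, creation (stdOrthonormalBasis ℂ (LinearMap.range (T : H →ₗ[ℂ] H)) k : H) *
      annihilation (ContinuousLinearMap.adjoint T
        (stdOrthonormalBasis ℂ (LinearMap.range (T : H →ₗ[ℂ] H)) k : H))
  else 0

/-- `N(|f⟩⟨g|) = A⁺(f) A(g)`. -/
theorem numberOp_rankOne (f g : H) :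
    numberOp (InnerProductSpace.rankOne ℂ f g) = creation f * annihilation g := by
  set T : H →L[ℂ] H := InnerProductSpace.rankOne ℂ f g with hT
  have hle : LinearMap.range (T : H →ₗ[ℂ] H) ≤ Submodule.span ℂ {f} := by
    rintro _ ⟨z, rfl⟩
    exact Submodule.mem_span_singleton.2 ⟨inner ℂ g z, by simp [hT]⟩
  have hfin : FiniteDimensional ℂ (LinearMap.range (T : H →ₗ[ℂ] H)) :=
    Submodule.finiteDimensional_of_le hle
  have hadj : ∀ e : H, annihilation (ContinuousLinearMap.adjoint T e)
      = (inner ℂ e f : ℂ) • annihilation g := by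
    intro e
    have : ContinuousLinearMap.adjoint T e = (inner ℂ f e : ℂ) • g := by
      refine ext_inner_right ℂ fun z => ?_
      rw [ContinuousLinearMap.adjoint_inner_left]
      simp [hT, inner_smul_left, inner_smul_right, mul_comm]
    rw [this, annihilation_smul, inner_conj_symm]
  have hsum : numberOp T = (∑ k, (inner ℂ
        (stdOrthonormalBasis ℂ (LinearMap.range (T : H →ₗ[ℂ] H)) k : H) f : ℂ) •
        creation (stdOrthonormalBasis ℂ (LinearMap.range (T : H →ₗ[ℂ] H)) k : H)) *
        annihilation g := by
    rw [numberOp, dif_pos hfin, Finset.sum_mul]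
    refine Finset.sum_congr rfl fun k _ => ?_
    rw [hadj, mul_smul_comm, smul_mul_assoc]
  rw [hsum]
  by_cases hg : g = 0
  · have : annihilation (0 : H) = 0 := by
      simpa using annihilation_smul (0 : ℂ) (0 : H)
    rw [hg, this, mul_zero, mul_zero]
  · have hf : f ∈ LinearMap.range (T : H →ₗ[ℂ] H) := by
      refine ⟨((inner ℂ g g : ℂ)⁻¹) • g, ?_⟩
      have hgg : (inner ℂ g g : ℂ) ≠ 0 := inner_self_ne_zero.2 hg
      change T _ = f
      rw [hT, InnerProductSpace.rankOne_apply, inner_smul_right, inv_mul_cancel₀ hgg, one_smul]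
    congr 1
    have key := (stdOrthonormalBasis ℂ (LinearMap.range (T : H →ₗ[ℂ] H))).sum_repr' ⟨f, hf⟩
    have key' := congrArg (Subtype.val) key
    rw [Submodule.coe_sum] at key'
    simp only [Submodule.coe_smul, Submodule.coe_inner] at key'
    let φ : H →ₗ[ℂ] CCRAlgebra H :=
      { toFun := creation, map_add' := creation_add, map_smul' := creation_smul }
    change ∑ k, _ • φ _ = φ f
    simp only [← map_smul, ← map_sum]
    rw [key']

/-- A one-parameter (strongly continuous) unitary group. -/
structure IsUnitaryGroup (S : ℝ → H →L[ℂ] H) : Prop where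
  mem_unitary : ∀ t, S t ∈ unitary (H →L[ℂ] H)
  map_add : ∀ s t, S (s + t) = S s ∘L S t
  continuous : ∀ x, Continuous fun t => S t x

/-- `p` is the function `E ↦ ⟨g, P_E f⟩`, where `P_E = (2π)⁻¹ ∫ dt S_t e^{-itE}` is understood in
the sense of distributions in the variable `E`: for every test function `ψ`,
`∫ dE ⟨g, P_E f⟩ ψ(E) = (2π)⁻¹ ∫ dt ⟨g, S_t f⟩ ∫ dE e^{-itE} ψ(E)`. -/
def IsEnergyDensity (S : ℝ → H →L[ℂ] H) (g f : H) (p : ℝ → ℂ) : Prop :=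
  Integrable p ∧ ∀ ψ : 𝓢(ℝ, ℂ),
    ∫ E : ℝ, p E * ψ E =
      (2 * Real.pi : ℂ)⁻¹ *
        ∫ t : ℝ, inner ℂ g (S t f) * ∫ E : ℝ, Complex.exp (-(Complex.I * t * E)) * ψ E

/-- The operator `N_{T,ω,ε}(t) = (e^{-itω/ε} / ε) N(S_{t/ε} T S_{-t/ε})`. -/
def scaledNumberOp (S : ℝ → H →L[ℂ] H) (T : H →L[ℂ] H) (ω ε t : ℝ) : CCRAlgebra H :=
  (Complex.exp (-(Complex.I * t * ω / ε)) / ε) • numberOp (S (t / ε) ∘L T ∘L S (-(t / ε)))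

/-- The multi-time correlation function, in the state `ω_{εn}`, of the operators
`N_{T_l,ω_l,ε}(t_l)` with `l ∈ s`, multiplied in increasing order of the indices. -/
def correlation {N : ℕ} (S : ℝ → H →L[ℂ] H) (n : H →L[ℂ] H) (T : Fin N → H →L[ℂ] H)
    (ω : Fin N → ℝ) (ε : ℝ) (t : Fin N → ℝ) (s : Finset (Fin N)) : ℂ :=
  gaussianState ((ε : ℂ) • n)
    ((s.sort (· ≤ ·)).map fun l => scaledNumberOp S (T l) (ω l) ε (t l)).prod

/-- The truncated functions `Wᵀ` of a family `W` of functions of the sets of indices, defined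
recursively by `W(s) = Wᵀ(s) + ∑_π ∏_{B ∈ π} Wᵀ(B)`, where `π` runs through the partitions of `s`
into at least two nonempty blocks. -/
def truncated {N : ℕ} (W : Finset (Fin N) → ℂ) (s : Finset (Fin N)) : ℂ :=
  W s - ∑ π : {π : Finpartition s // 2 ≤ π.parts.card},
    ∏ B : {B : Finset (Fin N) // B ∈ π.1.parts}, truncated W B.1
  termination_by s.card
  decreasing_by
    refine Finset.card_lt_card ((π.1.le B.2).ssubset_of_ne ?_)
    intro hB
    have h2 := π.2
    obtain ⟨C, hC, hne⟩ := Finset.exists_mem_ne (show 1 < π.1.parts.card from h2) B.1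
    have hd : Disjoint C B.1 := π.1.disjoint hC B.2 hne
    have hle : C ≤ s := π.1.le hC
    rw [hB] at hd
    exact π.1.ne_bot hC (disjoint_self.1 (hd.mono_right hle))

/-- The truncated correlation function `Wᵀ_ε(t_1, …, t_N)`. -/
def truncatedCorrelation {N : ℕ} (S : ℝ → H →L[ℂ] H) (n : H →L[ℂ] H) (T : Fin N → H →L[ℂ] H)
    (ω : Fin N → ℝ) (ε : ℝ) (t : Fin N → ℝ) : ℂ :=
  truncated (correlation S n T ω ε t) Finset.univ

/-- The two-point function of `A⁺_i = ε^{-1/2} A⁺(S_{t_i/ε} f_i)` and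
`A_j = ε^{-1/2} A(S_{t_j/ε} g_j)` in the state `ω_{εn}`, the two operators being taken in the order
in which they stand in the string `A⁺_1 A_1 A⁺_2 A_2 ⋯ A⁺_N A_N`. -/
def pairing {N : ℕ} (S : ℝ → H →L[ℂ] H) (n : H →L[ℂ] H) (f g : Fin N → H) (ε : ℝ)
    (t : Fin N → ℝ) (i j : Fin N) : ℂ :=
  let cre : CCRAlgebra H := ((Real.sqrt ε : ℂ)⁻¹) • creation (S (t i / ε) (f i))
  let ann : CCRAlgebra H := ((Real.sqrt ε : ℂ)⁻¹) • annihilation (S (t j / ε) (g j))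
  gaussianState ((ε : ℂ) • n) (if i ≤ j then cre * ann else ann * cre)

/-- The contribution to the correlation function of the diagram in which `A⁺_i` is paired with
`A_{σ i}` for every `i` (the energies `E_i` of the energy representation, in which
`S_t f = ∫ dE e^{itE} P_E f`, being integrated over). -/
def diagram {N : ℕ} (S : ℝ → H →L[ℂ] H) (n : H →L[ℂ] H) (f g : Fin N → H) (ω : Fin N → ℝ)
    (ε : ℝ) (t : Fin N → ℝ) (σ : Equiv.Perm (Fin N)) : ℂ :=
  Complex.exp (-(Complex.I * ∑ l, (ω l : ℂ) * t l / ε)) * ∏ i, pairing S n f g ε t i (σ i)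

/-- The diagram pairing `A⁺_i` with `A_{σ i}` is irreducible: there is no nonempty proper set `I`
of indices such that `i ∈ I ↔ σ i ∈ I` for all `i`. -/
def IsIrreducibleDiagram {N : ℕ} (σ : Equiv.Perm (Fin N)) : Prop :=
  ¬ ∃ I : Finset (Fin N), I.Nonempty ∧ I ≠ Finset.univ ∧ ∀ i, i ∈ I ↔ σ i ∈ I

/-- The diagram pairing `A⁺_i` with `A_{σ i}` is non-crossing: with `A⁺_i` at place `2i` and `A_j`
at place `2j + 1` of the string, no two pairs `{a < b}`, `{c < d}` satisfy `a < c < b < d`. -/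
def IsNonCrossingDiagram {N : ℕ} (σ : Equiv.Perm (Fin N)) : Prop :=
  ∀ i k : Fin N,
    ¬ (min (2 * (i : ℕ)) (2 * (σ i : ℕ) + 1) < min (2 * (k : ℕ)) (2 * (σ k : ℕ) + 1) ∧
      min (2 * (k : ℕ)) (2 * (σ k : ℕ) + 1) < max (2 * (i : ℕ)) (2 * (σ i : ℕ) + 1) ∧
      max (2 * (i : ℕ)) (2 * (σ i : ℕ) + 1) < max (2 * (k : ℕ)) (2 * (σ k : ℕ) + 1))

/-- The pairings of the diagram consisting of the outer pair `A⁺_1 A_N` and of the consecutive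
pairs `A_l A⁺_{l+1}`: `A⁺_1` is paired with `A_N`, and `A⁺_{l+1}` with `A_l`. -/
def outerDiagram (N : ℕ) : Equiv.Perm (Fin N) := (finRotate N)⁻¹

end Model

end LowDensity

end

/-! The proof passes to the energy representation, where every irreducible diagram is an average
of integrals of products of `m + 1` translated energy densities.

The algebraic part is combinatorial. Wick's formula for the words `A⁺₁ A₁ ⋯ A⁺ₖ Aₖ` is a permanent:
once the order of the letters has been built into a symmetric two-point function, the letters may
be rearranged freely (`wick_perm`), and expanding along the creation operators gives a sum over
permutations (`wick_ofFn_append`, `correlation_eq`). A permutation of a set is composed, in a unique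
way, of irreducible permutations of its orbits (`sum_permsOn_eq_sum_finpartition`), and a cluster
expansion determines its connected parts, so that the truncated functions are the sums over the
irreducible permutations, the diagrams `σ` that are cycles (`truncatedCorrelation_eq_sum`). In a
non-crossing diagram with `i ≤ σ i` the indices between `i` and `σ i` form an invariant set; hence
only `i = 0` has `i ≤ σ i` if the diagram is also irreducible, and then it is the outer diagram.

For the analytic part, `⟨g, S_t f⟩` is the Fourier integral of the energy density `p`. The
two-point function of the pair `A⁺ᵢ`, `A_{σ i}` consists of a term of order one and, if `σ i < i`,
a term of order `ε⁻¹`. It remains to see that the time integral of a product of such Fourier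
integrals along a cycle, against a test function, is of the order `ε ^ m`. By relabelling, the
cycle is the outer diagram. By Fubini's theorem the time integral becomes an integral over the
energies `E₀, …, Eₘ`; with `E_l = E₀ + ω̃_l + v_l`, the test function enters through its Fourier
transform at `(ω̃₀ / ε, v / ε)`, up to sign and a factor `2π` (`integral_cyclic_eq`). The function
`G v = ∫ dE r₀ E ∏ r_l (E + ω̃_l + v_l)` is bounded, by Hölder's inequality, and continuous, since
translations act continuously on `L^{m+1}`. Hence, divided by `ε ^ m`, the integral over `v`
converges to `G 0` times the integral of the Fourier transform over a hyperplane if `ω̃₀ = 0`, and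
to zero otherwise (`tendsto_integral_mul_piFourier`); by Fourier inversion the former is
an integral of the test function over the diagonal.

A diagram has at most as many factors `ε⁻¹` as there are indices with `σ i < i`. This number is at
most `m`, and it is `m` only for the outer diagram (`eq_outerDiagram_of_lt`), so that the other
irreducible diagrams vanish in the limit and the leading term of the outer one gives the whole
limit. -/

namespace LowDensity

/-! ### Non-crossing diagrams -/

section NonCrossing

variable {m : ℕ}

theorem outerDiagram_zero : outerDiagram (m + 1) 0 = Fin.last m := by
  rw [outerDiagram, Equiv.Perm.inv_eq_iff_eq, finRotate_last]

theorem outerDiagram_succ (l : Fin m) : outerDiagram (m + 1) l.succ = l.castSucc := by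
  rw [outerDiagram, Equiv.Perm.inv_eq_iff_eq, finRotate_apply, Fin.coeSucc_eq_succ]

/-- A permutation that moves every nonzero index downwards is the outer diagram: its values at
`0, …, l` exhaust `last, 0, …, l - 1`, step by step. -/
theorem eq_outerDiagram_of_lt (σ : Equiv.Perm (Fin (m + 1))) (h : ∀ i, i ≠ 0 → σ i < i) :
    σ = outerDiagram (m + 1) := by
  have key : ∀ (k : ℕ) (hk : k < m), σ ⟨k + 1, by omega⟩ = ⟨k, by omega⟩ := by
    intro k
    induction k using Nat.strong_induction_on with
    | _ k ih =>
      intro hk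
      have hlt := h ⟨k + 1, by omega⟩ (by simp [Fin.ext_iff])
      rw [Fin.lt_def] at hlt
      by_contra hne
      have hlt' : (σ ⟨k + 1, by omega⟩ : ℕ) < k := by
        have : (σ ⟨k + 1, by omega⟩ : ℕ) ≠ k := fun e => hne (Fin.ext e)
        simp only at hlt; omega
      have h1 := ih _ hlt' (by omega)
      have h2 := σ.injective (h1.trans (Fin.ext rfl : _ = σ ⟨k + 1, by omega⟩))
      simp only [Fin.mk.injEq] at h2
      omega
  have hs : ∀ l : Fin m, σ l.succ = l.castSucc := fun l => key l l.isLt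
  refine Equiv.ext fun i => ?_
  induction i using Fin.cases with
  | succ l => rw [hs, outerDiagram_succ]
  | zero =>
    rw [outerDiagram_zero]
    by_contra hne
    obtain ⟨j, hj⟩ := Fin.exists_castSucc_eq.2 hne
    have := σ.injective (hj.symm.trans (hs j).symm)
    exact absurd this.symm (Fin.succ_ne_zero j)

theorem isIrreducibleDiagram_outerDiagram : IsIrreducibleDiagram (outerDiagram (m + 1)) := by
  rintro ⟨I, ⟨i, hi⟩, hne, hI⟩
  have hall : ∀ j : Fin (m + 1), j ∈ I ↔ (0 : Fin (m + 1)) ∈ I := by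
    intro j
    induction j using Fin.induction with
    | zero => rfl
    | succ l ih => rw [hI, outerDiagram_succ, ih]
  exact hne (Finset.eq_univ_iff_forall.2 fun j => (hall j).2 ((hall i).1 hi))

theorem isNonCrossingDiagram_outerDiagram : IsNonCrossingDiagram (outerDiagram (m + 1)) := by
  intro i k
  induction i using Fin.cases <;> induction k using Fin.cases <;>
    simp only [outerDiagram_zero, outerDiagram_succ, Fin.val_zero, Fin.val_last, Fin.val_succ,
      Fin.val_castSucc] <;> omega

/-- If `A⁺_i` stands before its partner `A_{σ i}`, no pair of a non-crossing diagram leaves the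
stretch of the string between them. -/
theorem mem_Icc_of_isNonCrossingDiagram {σ : Equiv.Perm (Fin (m + 1))}
    (hσ : IsNonCrossingDiagram σ) {i : Fin (m + 1)} (hi : i ≤ σ i) {k : Fin (m + 1)}
    (hk : k ∈ Finset.Icc i (σ i)) : σ k ∈ Finset.Icc i (σ i) := by
  simp only [Finset.mem_Icc, Fin.le_def] at *
  have h1 := hσ i k
  have h2 := hσ k i
  by_cases hki : k = i
  · subst hki; omega
  · have : (k : ℕ) ≠ i := fun e => hki (Fin.ext e)
    omega

theorem isIrreducible_and_isNonCrossing_iff (σ : Equiv.Perm (Fin (m + 1))) :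
    (IsIrreducibleDiagram σ ∧ IsNonCrossingDiagram σ) ↔ σ = outerDiagram (m + 1) := by
  constructor
  · rintro ⟨hirr, hnc⟩
    refine eq_outerDiagram_of_lt σ fun i hi0 => ?_
    by_contra hlt
    rw [not_lt] at hlt
    have hmap : ∀ k ∈ Finset.Icc i (σ i), σ k ∈ Finset.Icc i (σ i) :=
      fun k hk => mem_Icc_of_isNonCrossingDiagram hnc hlt hk
    refine hirr ⟨Finset.Icc i (σ i), ⟨i, Finset.mem_Icc.2 ⟨le_rfl, hlt⟩⟩, fun huniv => ?_,
      fun k => ⟨hmap k, fun hk => ?_⟩⟩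
    · have : (0 : Fin (m + 1)) ∈ Finset.Icc i (σ i) := huniv ▸ Finset.mem_univ _
      exact hi0 (Fin.le_zero_iff.1 (Finset.mem_Icc.1 this).1)
    · -- a permutation mapping a finite set into itself maps it onto itself
      have himg : (Finset.Icc i (σ i)).image σ = Finset.Icc i (σ i) :=
        Finset.eq_of_subset_of_card_le (Finset.image_subset_iff.2 hmap)
          (Finset.card_image_of_injective _ σ.injective).ge
      rw [← himg, Finset.mem_image] at hk
      obtain ⟨k', hk', e⟩ := hk
      rwa [← σ.injective e]
  · rintro rfl
    exact ⟨isIrreducibleDiagram_outerDiagram, isNonCrossingDiagram_outerDiagram⟩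

end NonCrossing

/-! ### The two-point functions in the energy representation -/

section EnergyDensity

open scoped FourierTransform

variable {H : Type*} [NormedAddCommGroup H] [InnerProductSpace ℂ H]

/-- `⟨g, S_t f⟩ = ∫ dE ⟨g, P_E f⟩ e^{itE}`: both sides are continuous functions of `t`, and they
agree as distributions. -/
theorem IsEnergyDensity.inner_eq_integral [CompleteSpace H] {S : ℝ → H →L[ℂ] H}
    (hS : IsUnitaryGroup S)
    {g f : H} {p : ℝ → ℂ} (hp : IsEnergyDensity S g f p) (t : ℝ) :
    inner ℂ g (S t f) = ∫ E : ℝ, p E * Complex.exp (Complex.I * t * E) := by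
  obtain ⟨hint, hψ⟩ := hp
  have hpi : (2 * Real.pi : ℝ) ≠ 0 := by positivity
  have hcont1 : Continuous fun x : ℝ => (inner ℂ g (S (2 * Real.pi * x) f) : ℂ) :=
    (continuous_const.inner (hS.continuous f)).comp (continuous_const.mul continuous_id)
  have hcont2 : Continuous (𝓕⁻ p) := by
    have : Continuous (𝓕 p) := VectorFourier.fourierIntegral_continuous
      Real.continuous_fourierChar (innerSL ℝ).continuous₂ hint
    have e : 𝓕⁻ p = fun x => 𝓕 p (-x) := by
      ext x; exact Real.fourierInv_eq_fourier_neg p x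
    rw [e]; exact this.comp continuous_neg
  have hfun : (fun x : ℝ => (inner ℂ g (S (2 * Real.pi * x) f) : ℂ)) = 𝓕⁻ p := by
    refine (Continuous.ae_eq_iff_eq volume hcont1 hcont2).1 ?_
    refine ae_eq_of_integral_contDiff_smul_eq hcont1.locallyIntegrable hcont2.locallyIntegrable
      fun χ hχ hχc => ?_
    let χS : 𝓢(ℝ, ℂ) := HasCompactSupport.toSchwartzMap (f := fun x => (χ x : ℂ))
      (hχc.comp_left (g := fun y : ℝ => (y : ℂ)) (by simp))
      (Complex.ofRealCLM.contDiff.comp hχ)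
    have h := hψ (𝓕⁻ χS)
    have hF : ∀ t : ℝ, ∫ E : ℝ, Complex.exp (-(Complex.I * t * E)) * (𝓕⁻ χS) E
        = χ (t / (2 * Real.pi)) := by
      intro t
      have h1 : (𝓕 (𝓕⁻ χS)) (t / (2 * Real.pi)) = χS (t / (2 * Real.pi)) := by
        rw [FourierTransform.fourier_fourierInv_eq]
      rw [SchwartzMap.fourier_coe, Real.fourier_eq'] at h1
      refine Eq.trans (integral_congr_ae (ae_of_all _ fun E => ?_)) h1
      simp only [smul_eq_mul, RCLike.inner_apply, conj_trivial]
      congr 2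
      push_cast
      field_simp
    have hL : ∫ E : ℝ, p E * (𝓕⁻ χS) E = ∫ x : ℝ, χ x • 𝓕⁻ p x := by
      have h1 := VectorFourier.integral_fourierIntegral_smul_eq_flip (μ := volume) (ν := volume)
        (L := -(innerₗ ℝ)) (f := fun x => χS x) (g := p) Real.continuous_fourierChar
        (by
          simp only [LinearMap.neg_apply, innerₗ_apply_apply]
          exact continuous_inner.neg) χS.integrable hint
      refine Eq.trans (integral_congr_ae (ae_of_all _ fun E => ?_))
        (h1.trans (integral_congr_ae (ae_of_all _ fun x => ?_)))
      · simp only [SchwartzMap.fourierInv_coe, Real.fourierInv_eq, VectorFourier.fourierIntegral,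
          LinearMap.neg_apply, innerₗ_apply_apply, neg_neg, smul_eq_mul]
        rw [mul_comm]
      · simp only [Real.fourierInv_eq, VectorFourier.fourierIntegral, LinearMap.flip_apply,
          LinearMap.neg_apply, innerₗ_apply_apply, neg_neg, real_inner_comm]
        rfl
    have hR : ∫ x : ℝ, χ x • (inner ℂ g (S (2 * Real.pi * x) f) : ℂ)
        = (2 * Real.pi : ℂ)⁻¹ * ∫ t : ℝ, inner ℂ g (S t f) * (χ (t / (2 * Real.pi)) : ℂ) := by
      have h1 := Measure.integral_comp_mul_left
        (fun t : ℝ => (inner ℂ g (S t f) : ℂ) * (χ (t / (2 * Real.pi)) : ℂ)) (2 * Real.pi)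
      rw [abs_of_pos (by positivity), Complex.real_smul] at h1
      push_cast at h1
      rw [← h1]
      refine integral_congr_ae (ae_of_all _ fun x => ?_)
      simp only [Complex.real_smul]
      rw [mul_div_cancel_left₀ _ hpi, mul_comm]
    simp only [hF] at h
    rw [hR, ← h, hL]
  have := congrFun hfun (t / (2 * Real.pi))
  rw [show 2 * Real.pi * (t / (2 * Real.pi)) = t by field_simp] at this
  rw [this, Real.fourierInv_eq']
  refine integral_congr_ae (ae_of_all _ fun E => ?_)
  simp only [smul_eq_mul, RCLike.inner_apply, conj_trivial]
  rw [mul_comm]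
  congr 2
  push_cast
  field_simp
end EnergyDensity

/-! ### Integrals of products of translates -/

section TranslateProducts

variable {m : ℕ}

instance fact_one_le_natCast_succ : Fact (1 ≤ ((m + 1 : ℕ) : ENNReal)) := ⟨by simp⟩

theorem integrable_prod_of_memLp {r : Fin (m + 1) → ℝ → ℂ}
    (hr : ∀ i, MemLp (r i) ((m + 1 : ℕ) : ENNReal) volume) :
    Integrable fun E => ∏ i, r i E := by
  have h := MemLp.prod' (s := Finset.univ) (fun i _ => hr i)
  have e : (∑ i : Fin (m + 1), ((m + 1 : ℕ) : ENNReal)⁻¹)⁻¹ = 1 := by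
    rw [Finset.sum_const, Finset.card_univ, Fintype.card_fin, nsmul_eq_mul,
      ENNReal.mul_inv_cancel (by simp) (ENNReal.natCast_ne_top _), inv_one]
  rwa [e, memLp_one_iff_integrable] at h

/-- Hölder's inequality for `m + 1` functions with the common exponent `m + 1`. -/
theorem norm_integral_prod_le {r : Fin (m + 1) → ℝ → ℂ}
    (hr : ∀ i, MemLp (r i) ((m + 1 : ℕ) : ENNReal) volume) :
    ‖∫ E, ∏ i, r i E‖ ≤ ∏ i, (eLpNorm (r i) ((m + 1 : ℕ) : ENNReal) volume).toReal := by
  have h1 : ‖∫ E, ∏ i, r i E‖ₑ ≤ ∏ i, eLpNorm (r i) ((m + 1 : ℕ) : ENNReal) volume := by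
    refine (enorm_integral_le_lintegral_enorm _).trans ?_
    have h := ENNReal.lintegral_prod_norm_pow_le (μ := (volume : Measure ℝ)) Finset.univ
      (f := fun i E => ‖r i E‖ₑ ^ ((m + 1 : ℕ) : ℝ)) (p := fun _ => (((m + 1 : ℕ) : ℝ))⁻¹)
      (fun i _ => (hr i).1.enorm.pow_const _)
      (by
        rw [Finset.sum_const, Finset.card_univ, Fintype.card_fin, nsmul_eq_mul]
        exact mul_inv_cancel₀ (by positivity))
      (fun _ _ => by positivity)
    refine le_trans (le_of_eq ?_) (h.trans (le_of_eq ?_))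
    · refine lintegral_congr fun E => ?_
      simp only [enorm_eq_nnnorm, nnnorm_prod, ENNReal.ofNNReal_finsetProd]
      refine Finset.prod_congr rfl fun i _ => ?_
      rw [← ENNReal.rpow_mul, mul_inv_cancel₀ (by positivity), ENNReal.rpow_one]
    · refine Finset.prod_congr rfl fun i _ => ?_
      rw [eLpNorm_eq_lintegral_rpow_enorm_toReal (by simp) (ENNReal.natCast_ne_top _),
        ENNReal.toReal_natCast, one_div]
  have h2 := ENNReal.toReal_mono
    (ENNReal.prod_ne_top fun i _ => (hr i).eLpNorm_lt_top.ne) h1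
  rwa [toReal_enorm, ENNReal.toReal_prod] at h2

variable (m) in
/-- The multilinear form `(r₀, …, rₘ) ↦ ∫ ∏ rᵢ` on `L^{m+1}(ℝ)`. -/
noncomputable def prodForm : ContinuousMultilinearMap ℂ
    (fun _ : Fin (m + 1) => Lp ℂ ((m + 1 : ℕ) : ENNReal) (volume : Measure ℝ)) ℂ :=
  MultilinearMap.mkContinuous
    { toFun := fun r => ∫ E, ∏ i, (r i : ℝ → ℂ) E
      map_update_add' := fun {inst} r i x y => by
        obtain rfl : inst = instDecidableEqFin (m + 1) := Subsingleton.elim _ _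
        have hint : ∀ z, Integrable fun E => ∏ j, Function.update r i z j E :=
          fun z => integrable_prod_of_memLp fun j => Lp.memLp _
        rw [← integral_add (hint x) (hint y)]
        refine integral_congr_ae ?_
        filter_upwards [Lp.coeFn_add x y] with E hE
        simp only [← Finset.mul_prod_erase Finset.univ _ (Finset.mem_univ i),
          Function.update_self]
        have hne : ∀ z : Lp ℂ ((m + 1 : ℕ) : ENNReal) (volume : Measure ℝ),
            ∏ j ∈ Finset.univ.erase i, (Function.update r i z j : ℝ → ℂ) E
              = ∏ j ∈ Finset.univ.erase i, (r j : ℝ → ℂ) E := fun z =>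
          Finset.prod_congr rfl fun j hj => by
            rw [Function.update_of_ne (Finset.ne_of_mem_erase hj)]
        rw [hne, hne, hne, hE, Pi.add_apply, add_mul]
      map_update_smul' := fun {inst} r i c x => by
        obtain rfl : inst = instDecidableEqFin (m + 1) := Subsingleton.elim _ _
        rw [← integral_smul]
        refine integral_congr_ae ?_
        filter_upwards [Lp.coeFn_smul c x] with E hE
        simp only [← Finset.mul_prod_erase Finset.univ _ (Finset.mem_univ i),
          Function.update_self]
        have hne : ∀ z : Lp ℂ ((m + 1 : ℕ) : ENNReal) (volume : Measure ℝ),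
            ∏ j ∈ Finset.univ.erase i, (Function.update r i z j : ℝ → ℂ) E
              = ∏ j ∈ Finset.univ.erase i, (r j : ℝ → ℂ) E := fun z =>
          Finset.prod_congr rfl fun j hj => by
            rw [Function.update_of_ne (Finset.ne_of_mem_erase hj)]
        rw [hne, hne, hE, Pi.smul_apply, smul_mul_assoc] } 1
    (fun r => by
      rw [one_mul]
      exact norm_integral_prod_le fun i => Lp.memLp (r i))

theorem prodForm_apply
    (r : Fin (m + 1) → Lp ℂ ((m + 1 : ℕ) : ENNReal) (volume : Measure ℝ)) :
    prodForm m r = ∫ E, ∏ i, (r i : ℝ → ℂ) E := rfl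

theorem memLp_translate {r : ℝ → ℂ} {p : ENNReal} (hr : MemLp r p volume) (v : ℝ) :
    MemLp (fun E => r (E + v)) p volume :=
  hr.comp_measurePreserving (measurePreserving_add_right volume v)

theorem norm_integral_prod_translate_le {r : Fin (m + 1) → ℝ → ℂ}
    (hr : ∀ i, MemLp (r i) ((m + 1 : ℕ) : ENNReal) volume) (v : Fin (m + 1) → ℝ) :
    ‖∫ E, ∏ i, r i (E + v i)‖ ≤
      ∏ i, (eLpNorm (r i) ((m + 1 : ℕ) : ENNReal) volume).toReal := by
  refine (norm_integral_prod_le fun i => memLp_translate (hr i) (v i)).trans (le_of_eq ?_)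
  refine Finset.prod_congr rfl fun i _ => ?_
  congr 1
  exact eLpNorm_comp_measurePreserving (hr i).1 (measurePreserving_add_right volume (v i))

/-- Translations act continuously on `L^{m+1}`, hence the integral of a product of `m + 1`
translates depends continuously on the translation vectors. -/
theorem continuous_integral_prod_translate {r : Fin (m + 1) → ℝ → ℂ}
    (hr : ∀ i, MemLp (r i) ((m + 1 : ℕ) : ENNReal) volume) :
    Continuous fun v : Fin (m + 1) → ℝ => ∫ E, ∏ i, r i (E + v i) := by
  let τ : ℝ → C(ℝ, ℝ) := fun v => ⟨fun E => E + v, by fun_prop⟩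
  have hτ : Continuous τ :=
    (ContinuousMap.curry ⟨fun x : ℝ × ℝ => x.2 + x.1, by fun_prop⟩).continuous
  have hmp : ∀ v, MeasurePreserving (τ v) volume volume :=
    fun v => measurePreserving_add_right volume v
  have hc : Continuous fun v : Fin (m + 1) → ℝ =>
      prodForm m fun i => Lp.compMeasurePreserving (τ (v i)) (hmp (v i)) ((hr i).toLp) := by
    refine (prodForm m).cont.comp (continuous_pi fun i => ?_)
    exact Continuous.compMeasurePreservingLp continuous_const
      (hτ.comp (continuous_apply i) : Continuous fun v : Fin (m + 1) → ℝ => τ (v i))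
      (fun v => hmp (v i)) (ENNReal.natCast_ne_top _)
  refine hc.congr fun v => ?_
  rw [prodForm_apply]
  refine integral_congr_ae ?_
  have h1 : ∀ i, ∀ᵐ E : ℝ,
      (Lp.compMeasurePreserving (τ (v i)) (hmp (v i)) ((hr i).toLp) : ℝ → ℂ) E
        = r i (E + v i) := by
    intro i
    filter_upwards [Lp.coeFn_compMeasurePreserving ((hr i).toLp) (hmp (v i)),
      (hmp (v i)).quasiMeasurePreserving.ae (hr i).coeFn_toLp] with E h1 h2
    rw [h1, Function.comp_apply, h2]
    rfl
  filter_upwards [ae_all_iff.2 h1] with E hE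
  exact Finset.prod_congr rfl fun i _ => hE i

end TranslateProducts

/-! ### Fourier transforms of test functions -/

section TestFunctions

open scoped FourierTransform

variable {m : ℕ}

theorem exists_schwartz_bound {V : Type*} [NormedAddCommGroup V] [NormedSpace ℝ V]
    (φ : 𝓢(V, ℂ)) (k : ℕ) : ∃ C, 0 ≤ C ∧ ∀ x, ‖φ x‖ ≤ C * (1 + ‖x‖) ^ (-(k : ℝ)) := by
  refine ⟨2 ^ k * (Finset.Iic (k, 0)).sup (fun i => SchwartzMap.seminorm ℝ i.1 i.2) φ,
    by positivity, fun x => ?_⟩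
  have h := SchwartzMap.one_add_le_sup_seminorm_apply (𝕜 := ℝ) (m := (k, 0)) le_rfl le_rfl φ x
  rw [norm_iteratedFDeriv_zero] at h
  have hpos : 0 < (1 + ‖x‖) ^ k := by positivity
  rw [Real.rpow_neg (by positivity), Real.rpow_natCast, ← div_eq_mul_inv, le_div_iff₀ hpos, mul_comm]
  exact h

theorem norm_vecCons_ge_left (x : ℝ) (s : Fin m → ℝ) : ‖x‖ ≤ ‖Matrix.vecCons x s‖ := by
  simpa using norm_le_pi_norm (Matrix.vecCons x s) 0

theorem norm_vecCons_ge_right (x : ℝ) (s : Fin m → ℝ) : ‖s‖ ≤ ‖Matrix.vecCons x s‖ :=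
  (pi_norm_le_iff_of_nonneg (norm_nonneg _)).2 fun i => by
    simpa using norm_le_pi_norm (Matrix.vecCons x s) i.succ

theorem measurePreserving_vecCons :
    MeasurePreserving (fun y : ℝ × (Fin m → ℝ) => (Matrix.vecCons y.1 y.2 : Fin (m + 1) → ℝ))
      (volume.prod volume) volume := by
  have h := (volume_preserving_piFinSuccAbove (fun _ : Fin (m + 1) => ℝ) 0).symm
  convert! h using 1
  ext y i
  simp [MeasurableEquiv.piFinSuccAbove, Matrix.vecCons]

theorem measurableEmbedding_vecCons :
    MeasurableEmbedding
      (fun y : ℝ × (Fin m → ℝ) => (Matrix.vecCons y.1 y.2 : Fin (m + 1) → ℝ)) := by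
  have h := (MeasurableEquiv.piFinSuccAbove (fun _ : Fin (m + 1) => ℝ) 0).symm.measurableEmbedding
  convert! h using 1
  ext y i
  simp [MeasurableEquiv.piFinSuccAbove, Matrix.vecCons]

/-- The Fourier transform `ξ ↦ ∫ dx e^{-2πi ξ·x} φ(x)` of a function on `ℝ^N`, a power of `ℝ`
with its sup norm. -/
noncomputable def piFourier {N : ℕ} (φ : (Fin N → ℝ) → ℂ) (ξ : Fin N → ℝ) : ℂ :=
  ∫ x : Fin N → ℝ, Complex.exp (-(2 * Real.pi * Complex.I * ∑ j, ξ j * x j)) * φ x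

theorem piFourier_eq {N : ℕ} (φ : (Fin N → ℝ) → ℂ) (ξ : Fin N → ℝ) :
    piFourier φ ξ =
      𝓕 (fun v : EuclideanSpace ℝ (Fin N) => φ v.ofLp) (WithLp.toLp 2 ξ) := by
  rw [piFourier, Real.fourier_eq', ← (PiLp.volume_preserving_ofLp (Fin N)).integral_comp
    (MeasurableEquiv.toLp 2 (Fin N → ℝ)).symm.measurableEmbedding]
  refine integral_congr_ae (ae_of_all _ fun v => ?_)
  simp only [PiLp.inner_apply, RCLike.inner_apply, conj_trivial, smul_eq_mul]
  congr 2
  push_cast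
  ring

/-- A test function on `ℝ^N` as a test function on the Euclidean space. -/
noncomputable def toEuclidean {N : ℕ} (φ : 𝓢(Fin N → ℝ, ℂ)) : 𝓢(EuclideanSpace ℝ (Fin N), ℂ) :=
  SchwartzMap.compCLMOfContinuousLinearEquiv ℝ (EuclideanSpace.equiv (Fin N) ℝ) φ

theorem piFourier_schwartz {N : ℕ} (φ : 𝓢(Fin N → ℝ, ℂ)) (ξ : Fin N → ℝ) :
    piFourier φ ξ = (𝓕 (toEuclidean φ)) (WithLp.toLp 2 ξ) := by
  rw [piFourier_eq, SchwartzMap.fourier_coe]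
  rfl

theorem continuous_piFourier {N : ℕ} (φ : 𝓢(Fin N → ℝ, ℂ)) : Continuous (piFourier φ) := by
  have h : Continuous fun ξ : Fin N → ℝ => (𝓕 (toEuclidean φ)) (WithLp.toLp 2 ξ) :=
    (𝓕 (toEuclidean φ)).continuous.comp (PiLp.continuous_toLp 2 _)
  exact h.congr fun ξ => (piFourier_schwartz φ ξ).symm

theorem exists_piFourier_bound {N : ℕ} (φ : 𝓢(Fin N → ℝ, ℂ)) (k : ℕ) :
    ∃ C, 0 ≤ C ∧ ∀ ξ, ‖piFourier φ ξ‖ ≤ C * (1 + ‖ξ‖) ^ (-(k : ℝ)) := by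
  obtain ⟨C, hC, h⟩ := exists_schwartz_bound (𝓕 (toEuclidean φ)) k
  refine ⟨C, hC, fun ξ => ?_⟩
  rw [piFourier_schwartz]
  refine (h _).trans (mul_le_mul_of_nonneg_left ?_ hC)
  refine Real.rpow_le_rpow_of_nonpos (by positivity) ?_ (by simp)
  gcongr
  exact (pi_norm_le_iff_of_nonneg (norm_nonneg _)).2 fun i =>
    PiLp.norm_apply_le (WithLp.toLp 2 ξ) i

/-- Partial Fourier inversion: integrating the Fourier transform over the hyperplane `ξ₀ = 0`
gives the integral of the function over the line `x₁ = ⋯ = xₘ = 0`. -/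
theorem integral_piFourier_vecCons_zero (φ : 𝓢(Fin (m + 1) → ℝ, ℂ)) :
    ∫ u : Fin m → ℝ, piFourier φ (Matrix.vecCons 0 u)
      = ∫ x : ℝ, φ (Matrix.vecCons x 0) := by
  -- the marginal of `φ` on the last `m` coordinates
  let Φ : (Fin m → ℝ) → ℂ := fun s => ∫ x : ℝ, φ (Matrix.vecCons x s)
  have hprod : Integrable (fun y : ℝ × (Fin m → ℝ) => φ (Matrix.vecCons y.1 y.2))
      (volume.prod volume) :=
    (measurePreserving_vecCons.integrable_comp_emb measurableEmbedding_vecCons).2 φ.integrable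
  have hΦint : Integrable Φ := hprod.integral_prod_right
  have hΦcont : Continuous Φ := by
    obtain ⟨C, hC, hb⟩ := exists_schwartz_bound φ 2
    refine continuous_of_dominated (bound := fun x : ℝ => C * (1 + ‖x‖) ^ (-((2 : ℕ) : ℝ)))
      (fun s => (φ.continuous.comp (by fun_prop)).aestronglyMeasurable)
      (fun s => ae_of_all _ fun x => (hb _).trans ?_)
      ((integrable_one_add_norm (by simp)).const_mul C)
      (ae_of_all _ fun x => φ.continuous.comp (by fun_prop))
    refine mul_le_mul_of_nonneg_left ?_ hC
    refine Real.rpow_le_rpow_of_nonpos (by positivity) ?_ (by simp)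
    gcongr
    exact norm_vecCons_ge_left x s
  have hFΦ : ∀ u, piFourier φ (Matrix.vecCons 0 u) = piFourier Φ u := by
    intro u
    rw [piFourier, ← measurePreserving_vecCons.integral_comp measurableEmbedding_vecCons,
      integral_prod_symm, piFourier]
    · refine integral_congr_ae (ae_of_all _ fun s => ?_)
      simp only [Fin.sum_univ_succ, Matrix.cons_val_zero, Matrix.cons_val_succ,
        zero_mul, zero_add]
      exact integral_const_mul _ _
    · refine hprod.bdd_mul (c := 1) (Continuous.aestronglyMeasurable ?_) (ae_of_all _ fun y => ?_)
      · fun_prop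
      · rw [Complex.norm_exp]
        simp
  have hFint : Integrable fun u : Fin m → ℝ => piFourier Φ u := by
    obtain ⟨C, hC, hb⟩ := exists_piFourier_bound φ (m + 1)
    refine Integrable.mono' ((integrable_one_add_norm (E := Fin m → ℝ) (μ := volume)
      (r := ((m + 1 : ℕ) : ℝ)) (by simp)).const_mul C) ?_ (ae_of_all _ fun u => ?_)
    · simp only [← hFΦ]
      exact ((continuous_piFourier φ).comp (by fun_prop)).aestronglyMeasurable
    · rw [← hFΦ]
      refine (hb _).trans (mul_le_mul_of_nonneg_left ?_ hC)
      refine Real.rpow_le_rpow_of_nonpos (by positivity) ?_ (by simp only [Left.neg_nonpos_iff]; positivity)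
      gcongr
      exact norm_vecCons_ge_right 0 u
  simp only [hFΦ]
  set ΦE : EuclideanSpace ℝ (Fin m) → ℂ := fun v => Φ v.ofLp with hΦE
  have hmp := PiLp.volume_preserving_ofLp (Fin m)
  have hme := (MeasurableEquiv.toLp 2 (Fin m → ℝ)).symm.measurableEmbedding
  have hE1 : Integrable ΦE := (hmp.integrable_comp_emb hme).2 hΦint
  have hE2 : Integrable (𝓕 ΦE) := by
    refine ((hmp.integrable_comp_emb hme).2 hFint).congr (ae_of_all _ fun v => ?_)
    simp only [Function.comp_apply, piFourier_eq]
    rfl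
  have hinv := hE1.fourierInv_fourier_eq hE2 (v := 0)
    ((hΦcont.comp (PiLp.continuous_ofLp 2 _)).continuousAt)
  rw [Real.fourierInv_eq'] at hinv
  simp only [inner_zero_right, mul_zero, Complex.ofReal_zero, zero_mul, Complex.exp_zero,
    one_smul] at hinv
  rw [← hmp.integral_comp hme]
  simp only [piFourier_eq]
  exact hinv

end TestFunctions

/-! ### The scaling limit of the cyclic diagram -/

section ScalingLimit

variable {m : ℕ}

/-- Scaling limit in the energy variables: rescaled by `ε`, the test function concentrates at the
origin of the variables `v`, and its Fourier transform decays unless `a = 0`. -/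
theorem tendsto_integral_mul_piFourier (φ : 𝓢(Fin (m + 1) → ℝ, ℂ)) (a : ℝ)
    {G : (Fin m → ℝ) → ℂ} (hG : Continuous G) {K : ℝ} (hK : ∀ v, ‖G v‖ ≤ K) :
    Tendsto (fun ε : ℝ => ((ε : ℂ)⁻¹) ^ m * ∫ v : Fin m → ℝ, G v *
        piFourier φ (Matrix.vecCons (a / (2 * Real.pi * ε)) ((-(2 * Real.pi * ε)⁻¹) • v)))
      (𝓝[>] 0)
      (𝓝 ((2 * Real.pi : ℂ) ^ m * (if a = 0 then 1 else 0) * G 0 *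
        ∫ x : ℝ, φ (Matrix.vecCons x 0))) := by
  have hscale : ∀ ε : ℝ, 0 < ε → ((ε : ℂ)⁻¹) ^ m * ∫ v : Fin m → ℝ, G v *
        piFourier φ (Matrix.vecCons (a / (2 * Real.pi * ε)) ((-(2 * Real.pi * ε)⁻¹) • v))
      = (2 * Real.pi : ℂ) ^ m * ∫ u : Fin m → ℝ, G ((-(2 * Real.pi * ε)) • u) *
        piFourier φ (Matrix.vecCons (a / (2 * Real.pi * ε)) u) := by
    intro ε hε
    have hc : (2 * Real.pi * ε) ≠ 0 := by positivity
    have h := Measure.integral_comp_smul (volume : Measure (Fin m → ℝ))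
      (fun v => G v * piFourier φ (Matrix.vecCons (a / (2 * Real.pi * ε))
        ((-(2 * Real.pi * ε)⁻¹) • v))) (-(2 * Real.pi * ε))
    simp only [smul_smul, neg_mul_neg, inv_mul_cancel₀ hc, one_smul] at h
    rw [h, Module.finrank_fin_fun, abs_inv, abs_pow, abs_neg, abs_of_pos (by positivity),
      Complex.real_smul]
    have hε' : (ε : ℂ) ≠ 0 := by exact_mod_cast hε.ne'
    have hpi : (Real.pi : ℂ) ≠ 0 := by exact_mod_cast Real.pi_ne_zero
    push_cast
    rw [mul_pow, inv_pow]
    generalize (∫ v : Fin m → ℝ, G v * piFourier φ (Matrix.vecCons (a / (2 * Real.pi * ε))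
      ((-(2 * Real.pi * ε)⁻¹) • v))) = J
    have h1 := pow_ne_zero m hε'
    have h2 := pow_ne_zero m (mul_ne_zero two_ne_zero hpi)
    field_simp
    ring
  obtain ⟨C, hC, hb⟩ := exists_piFourier_bound φ (m + 1)
  have hK0 : 0 ≤ K := (norm_nonneg _).trans (hK 0)
  have hbound : ∀ (b : ℝ) (u : Fin m → ℝ), ‖piFourier φ (Matrix.vecCons b u)‖
      ≤ C * (1 + ‖u‖) ^ (-((m + 1 : ℕ) : ℝ)) := by
    intro b u
    refine (hb _).trans (mul_le_mul_of_nonneg_left ?_ hC)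
    refine Real.rpow_le_rpow_of_nonpos (by positivity) ?_
      (by simp only [Left.neg_nonpos_iff]; positivity)
    gcongr
    exact norm_vecCons_ge_right b u
  have hlim : Tendsto (fun ε : ℝ => ∫ u : Fin m → ℝ, G ((-(2 * Real.pi * ε)) • u) *
        piFourier φ (Matrix.vecCons (a / (2 * Real.pi * ε)) u)) (𝓝[>] 0)
      (𝓝 (∫ u : Fin m → ℝ, (if a = 0 then 1 else 0) * G 0 *
        piFourier φ (Matrix.vecCons 0 u))) := by
    refine tendsto_integral_filter_of_dominated_convergence
      (fun u => K * (C * (1 + ‖u‖) ^ (-((m + 1 : ℕ) : ℝ)))) ?_ ?_ ?_ ?_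
    · refine Eventually.of_forall fun ε => Continuous.aestronglyMeasurable ?_
      exact (hG.comp (by fun_prop)).mul ((continuous_piFourier φ).comp (by fun_prop))
    · refine Eventually.of_forall fun ε => ae_of_all _ fun u => ?_
      rw [norm_mul]
      exact mul_le_mul (hK _) (hbound _ u) (norm_nonneg _) hK0
    · exact ((integrable_one_add_norm (E := Fin m → ℝ) (μ := volume)
        (r := ((m + 1 : ℕ) : ℝ)) (by simp)).const_mul C).const_mul K
    · refine ae_of_all _ fun u => ?_
      have hGu : Tendsto (fun ε : ℝ => G ((-(2 * Real.pi * ε)) • u)) (𝓝[>] 0) (𝓝 (G 0)) := by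
        have hc : Continuous fun ε : ℝ => G ((-(2 * Real.pi * ε)) • u) := hG.comp (by fun_prop)
        have := hc.tendsto 0
        simp only [mul_zero, neg_zero, zero_smul] at this
        exact this.mono_left nhdsWithin_le_nhds
      by_cases ha : a = 0
      · subst ha
        simp only [zero_div, if_true, one_mul]
        exact hGu.mul tendsto_const_nhds
      · simp only [if_neg ha, zero_mul]
        rw [← mul_zero (G 0)]
        refine hGu.mul ?_
        -- the Fourier transform is evaluated at `a / (2πε)`, which tends to infinity
        have habs : Tendsto (fun ε : ℝ => 1 + |a| / (2 * Real.pi) * ε⁻¹) (𝓝[>] 0) atTop :=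
          tendsto_atTop_add_const_left _ _
            (tendsto_inv_nhdsGT_zero.const_mul_atTop (by positivity))
        have hpow := (tendsto_rpow_neg_atTop (y := ((m + 1 : ℕ) : ℝ)) (by positivity)).comp habs
        have hpow' := hpow.const_mul C
        rw [mul_zero] at hpow'
        refine squeeze_zero_norm' ?_ hpow'
        filter_upwards [self_mem_nhdsWithin] with ε hε
        rw [Set.mem_Ioi] at hε
        refine (hb _).trans (mul_le_mul_of_nonneg_left ?_ hC)
        refine Real.rpow_le_rpow_of_nonpos (by positivity) ?_
          (by simp only [Left.neg_nonpos_iff]; positivity)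
        refine add_le_add_right (le_trans (le_of_eq ?_) (norm_vecCons_ge_left _ u)) 1
        rw [Real.norm_eq_abs, abs_div, abs_of_pos (a := 2 * Real.pi * ε) (by positivity)]
        field_simp
  have := hlim.const_mul ((2 * Real.pi : ℂ) ^ m)
  rw [integral_const_mul, integral_piFourier_vecCons_zero] at this
  refine (this.congr' ?_).trans (le_of_eq ?_)
  · filter_upwards [self_mem_nhdsWithin] with ε hε
    exact (hscale ε hε).symm
  · congr 1; ring

/-- Fubini's theorem: passing from the time to the energy representation. -/
theorem integral_prod_integral_mul {N : ℕ} {r : Fin N → ℝ → ℂ} (hr : ∀ i, Integrable (r i))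
    {l : (Fin N → ℝ) → Fin N → ℝ} (hl : Continuous l) {ψ : (Fin N → ℝ) → ℂ}
    (hψ : Integrable ψ) :
    ∫ x, (∏ i, ∫ E : ℝ, r i E * Complex.exp (Complex.I * l x i * E)) * ψ x
      = ∫ E : Fin N → ℝ, (∏ i, r i (E i)) *
          ∫ x, Complex.exp (Complex.I * ∑ i, l x i * E i) * ψ x := by
  have hRint : Integrable (fun E : Fin N → ℝ => ∏ i, r i (E i)) := Integrable.fintype_prod hr
  have h1 : ∀ x, (∏ i, ∫ E : ℝ, r i E * Complex.exp (Complex.I * l x i * E)) * ψ x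
      = ∫ E : Fin N → ℝ, Complex.exp (Complex.I * ∑ i, l x i * E i) *
          ((∏ i, r i (E i)) * ψ x) := by
    intro x
    rw [← integral_fintype_prod_volume_eq_prod, ← integral_mul_const]
    refine integral_congr_ae (ae_of_all _ fun E => ?_)
    simp only [Finset.prod_mul_distrib, ← Complex.exp_sum]
    push_cast
    rw [Finset.mul_sum, mul_comm (∏ i, r i (E i)), mul_assoc]
    congr 2
    exact Finset.sum_congr rfl fun i _ => by ring
  simp only [h1]
  rw [integral_integral_swap]
  · refine integral_congr_ae (ae_of_all _ fun E => ?_)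
    simp only
    rw [← integral_const_mul]
    refine integral_congr_ae (ae_of_all _ fun x => ?_)
    simp only
    ring
  · have hprod : Integrable (fun y : (Fin N → ℝ) × (Fin N → ℝ) =>
        (∏ i, r i (y.2 i)) * ψ y.1) (volume.prod volume) := by
      have := hψ.mul_prod hRint
      exact this.congr (ae_of_all _ fun y => mul_comm _ _)
    refine hprod.bdd_mul (c := 1) (Continuous.aestronglyMeasurable ?_) (ae_of_all _ fun y => ?_)
    · fun_prop
    · rw [Complex.norm_exp]
      simp

/-- In the energy representation, with the energies of the pairs centred at `E₀ + c l`, the time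
integral of a cyclic diagram is an average of the integrals of products of translates. -/
theorem integral_cyclic_eq {r : Fin (m + 1) → ℝ → ℂ} (hr : ∀ i, Integrable (r i))
    (φ : 𝓢(Fin (m + 1) → ℝ, ℂ)) (a : ℝ) (c : Fin m → ℝ) {ε : ℝ} (hε : 0 < ε) :
    ∫ x : Fin (m + 1) → ℝ, (∏ i, ∫ E : ℝ, r i E * Complex.exp (Complex.I *
          ((Matrix.vecCons (-(∑ l : Fin m, x l.succ) / ε) (fun l : Fin m => x l.succ / ε) :
            Fin (m + 1) → ℝ) i) * E)) *
        (Complex.exp (-(Complex.I * ((a * x 0 + ∑ l, c l * x l.succ : ℝ) : ℂ) / ε)) * φ x)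
      = ∫ v : Fin m → ℝ, (∫ E : ℝ, ∏ i, r i (E + (Matrix.vecCons 0 (c + v) : Fin (m + 1) → ℝ) i)) *
          piFourier φ (Matrix.vecCons (a / (2 * Real.pi * ε)) ((-(2 * Real.pi * ε)⁻¹) • v)) := by
  have hψ : Integrable fun x : Fin (m + 1) → ℝ =>
      Complex.exp (-(Complex.I * ((a * x 0 + ∑ l, c l * x l.succ : ℝ) : ℂ) / ε)) * φ x := by
    refine φ.integrable.bdd_mul (c := 1) (Continuous.aestronglyMeasurable ?_)
      (ae_of_all _ fun x => ?_)
    · fun_prop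
    · rw [Complex.norm_exp, mul_div_assoc, ← Complex.ofReal_div]
      simp
  rw [integral_prod_integral_mul hr (by fun_prop) hψ]
  have hin : ∀ E : Fin (m + 1) → ℝ, ∫ x : Fin (m + 1) → ℝ,
      Complex.exp (Complex.I * ((∑ i, (Matrix.vecCons (-(∑ l : Fin m, x l.succ) / ε)
        (fun l : Fin m => x l.succ / ε) : Fin (m + 1) → ℝ) i * E i : ℝ) : ℂ)) *
        (Complex.exp (-(Complex.I * ((a * x 0 + ∑ l, c l * x l.succ : ℝ) : ℂ) / ε)) * φ x)
      = piFourier φ (Matrix.vecCons (a / (2 * Real.pi * ε))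
          (fun l => (2 * Real.pi * ε)⁻¹ * (c l + E 0 - E l.succ))) := by
    intro E
    rw [piFourier]
    refine integral_congr_ae (ae_of_all _ fun x => ?_)
    simp only
    rw [← mul_assoc, ← Complex.exp_add]
    congr 2
    simp only [Fin.sum_univ_succ, Matrix.cons_val_zero, Matrix.cons_val_succ]
    have hreal : (-(∑ l : Fin m, x l.succ) / ε * E 0 + ∑ l : Fin m, x l.succ / ε * E l.succ)
        - (a * x 0 + ∑ l, c l * x l.succ) / ε
        = -(2 * Real.pi * (a / (2 * Real.pi * ε) * x 0 +
          ∑ l : Fin m, (2 * Real.pi * ε)⁻¹ * (c l + E 0 - E l.succ) * x l.succ)) := by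
      have e1 : ∑ l : Fin m, (2 * Real.pi * ε)⁻¹ * (c l + E 0 - E l.succ) * x l.succ
          = (2 * Real.pi * ε)⁻¹ * (∑ l, c l * x l.succ + E 0 * (∑ l : Fin m, x l.succ)
            - ∑ l : Fin m, x l.succ * E l.succ) := by
        rw [Finset.mul_sum Finset.univ _ (E 0), ← Finset.sum_add_distrib,
          ← Finset.sum_sub_distrib, Finset.mul_sum]
        exact Finset.sum_congr rfl fun l _ => by ring
      have e2 : ∑ l : Fin m, x l.succ / ε * E l.succ
          = ε⁻¹ * ∑ l : Fin m, x l.succ * E l.succ := by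
        rw [Finset.mul_sum]
        exact Finset.sum_congr rfl fun l _ => by ring
      rw [e1, e2]
      field_simp
      ring
    have hc := congrArg (fun y : ℝ => Complex.I * (y : ℂ)) hreal
    simp only [Complex.ofReal_sub, Complex.ofReal_neg, Complex.ofReal_mul, Complex.ofReal_div,
      Complex.ofReal_ofNat] at hc ⊢
    linear_combination hc
  simp only [hin]
  -- split off the first energy and shift the others by it
  let F : ℝ × (Fin m → ℝ) → ℂ := fun y =>
    (∏ i, r i ((Matrix.vecCons y.1 y.2 : Fin (m + 1) → ℝ) i)) *
      piFourier φ (Matrix.vecCons (a / (2 * Real.pi * ε))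
        (fun l => (2 * Real.pi * ε)⁻¹ * (c l + y.1 - y.2 l)))
  have hF : Integrable F (volume.prod volume) := by
    have h1 := (measurePreserving_vecCons.integrable_comp_emb measurableEmbedding_vecCons).2
      (Integrable.fintype_prod hr : Integrable fun E : Fin (m + 1) → ℝ => ∏ i, r i (E i))
    obtain ⟨C, hC, hb⟩ := exists_piFourier_bound φ 0
    refine h1.mul_bdd (c := C) (Continuous.aestronglyMeasurable ?_) (ae_of_all _ fun y => ?_)
    · exact (continuous_piFourier φ).comp (by fun_prop)
    · simpa using hb _
  have hmp : MeasurePreserving (fun y : ℝ × (Fin m → ℝ) =>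
      ((y.1, y.2 + fun l => y.1 + c l) : ℝ × (Fin m → ℝ)))
      (volume.prod volume) (volume.prod volume) :=
    (MeasurePreserving.id volume).skew_product
      (g := fun (x : ℝ) (v : Fin m → ℝ) => v + fun l => x + c l) (by fun_prop)
      (ae_of_all _ fun x => (measurePreserving_add_right volume _).map_eq)
  have hFs := hmp.integrable_comp_of_integrable hF
  rw [← measurePreserving_vecCons.integral_comp measurableEmbedding_vecCons]
  simp only [Matrix.cons_val_zero, Matrix.cons_val_succ]
  change ∫ y, F y ∂(volume.prod volume) = _
  rw [integral_prod _ hF]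
  have hshift : ∀ x : ℝ, ∫ w : Fin m → ℝ, F (x, w)
      = ∫ v : Fin m → ℝ, F (x, v + fun l => x + c l) := fun x =>
    (integral_add_right_eq_self (fun w => F (x, w)) _).symm
  simp only [hshift]
  rw [integral_integral_swap (f := fun x v => F (x, v + fun l => x + c l)) hFs]
  refine integral_congr_ae (ae_of_all _ fun v => ?_)
  simp only [F]
  rw [← integral_mul_const]
  refine integral_congr_ae (ae_of_all _ fun E => ?_)
  simp only
  refine congrArg₂ (· * ·) (Finset.prod_congr rfl fun i _ => congrArg (r i) ?_)
    (congrArg (fun w => piFourier φ (Matrix.vecCons _ w)) (funext fun l => ?_))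
  · induction i using Fin.cases with
    | zero => simp
    | succ l => simp only [Matrix.cons_val_succ, Pi.add_apply]; ring
  · simp only [Pi.add_apply, Pi.smul_apply, smul_eq_mul]
    ring

end ScalingLimit

/-! ### Irreducible diagrams as cycles -/

section Cyclic

variable {m : ℕ}

/-- The change of the time variables to the first time and the successive differences. -/
def timeDiff (m : ℕ) : (Fin (m + 1) → ℝ) →ₗ[ℝ] (Fin (m + 1) → ℝ) where
  toFun t := Matrix.vecCons (t 0) fun l : Fin m => t l.succ - t l.castSucc
  map_add' s t := by
    ext i
    induction i using Fin.cases <;> simp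
    ring
  map_smul' z t := by
    ext i
    induction i using Fin.cases <;> simp
    ring

@[simp] theorem timeDiff_zero (t : Fin (m + 1) → ℝ) : timeDiff m t 0 = t 0 := rfl

@[simp] theorem timeDiff_succ (t : Fin (m + 1) → ℝ) (l : Fin m) :
    timeDiff m t l.succ = t l.succ - t l.castSucc := rfl

theorem det_timeDiff : LinearMap.det (timeDiff m) = 1 := by
  rw [← LinearMap.det_toMatrix', Matrix.det_of_isLowerTriangular]
  · refine Finset.prod_eq_one fun i _ => ?_
    rw [LinearMap.toMatrix'_apply]
    induction i using Fin.cases with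
    | zero => simp
    | succ l =>
      have : l.castSucc ≠ l.succ := (Fin.castSucc_lt_succ).ne
      simp [this]
  · intro i j hij
    rw [OrderDual.toDual_lt_toDual] at hij
    rw [LinearMap.toMatrix'_apply]
    induction i using Fin.cases with
    | zero => simp [hij.ne]
    | succ l =>
      have : l.castSucc ≠ j := (Fin.castSucc_lt_succ.trans hij).ne
      simp [this, hij.ne]

theorem measurePreserving_timeDiff : MeasurePreserving (timeDiff m) volume volume := by
  refine ⟨(LinearMap.continuous_of_finiteDimensional _).measurable, ?_⟩
  rw [Real.map_linearMap_volume_pi_eq_smul_volume_pi (by rw [det_timeDiff]; exact one_ne_zero),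
    det_timeDiff]
  simp

/-- `timeDiff` as a continuous linear equivalence. -/
noncomputable def timeDiffEquiv (m : ℕ) : (Fin (m + 1) → ℝ) ≃L[ℝ] (Fin (m + 1) → ℝ) :=
  (LinearMap.equivOfDetNeZero (timeDiff m) (by rw [det_timeDiff]; exact one_ne_zero)
    ).toContinuousLinearEquiv

theorem timeDiffEquiv_apply (t : Fin (m + 1) → ℝ) : timeDiffEquiv m t = timeDiff m t := rfl

theorem sum_Iic_timeDiff (t : Fin (m + 1) → ℝ) (i : Fin (m + 1)) :
    ∑ j ∈ Finset.Iic i, timeDiff m t j = t i := by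
  induction i using Fin.induction with
  | zero =>
    have : (Finset.Iic 0 : Finset (Fin (m + 1))) = {0} := by ext j; simp
    rw [this, Finset.sum_singleton, timeDiff_zero]
  | succ l ih =>
    have : Finset.Iic l.succ = insert l.succ (Finset.Iic l.castSucc) := by
      ext j
      simp only [Finset.mem_Iic, Finset.mem_insert, Fin.le_def, Fin.ext_iff, Fin.val_succ,
        Fin.val_castSucc]
      omega
    rw [this, Finset.sum_insert (by simp), ih, timeDiff_succ]
    ring

theorem sum_timeDiff_succ (t : Fin (m + 1) → ℝ) :
    ∑ l : Fin m, timeDiff m t l.succ = t (Fin.last m) - t 0 := by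
  have h := sum_Iic_timeDiff t (Fin.last m)
  have : Finset.Iic (Fin.last m) = Finset.univ := by ext j; simp [Fin.le_last]
  rw [this, Fin.sum_univ_succ, timeDiff_zero] at h
  linarith

/-- Summation by parts. -/
theorem sum_mul_eq_sum_timeDiff (ω t : Fin (m + 1) → ℝ) :
    ∑ l, ω l * t l = ∑ j, (∑ l ∈ Finset.Ici j, ω l) * timeDiff m t j := by
  calc ∑ l, ω l * t l = ∑ l, ∑ j ∈ Finset.Iic l, ω l * timeDiff m t j := by
        refine Finset.sum_congr rfl fun l _ => ?_
        rw [← Finset.mul_sum, sum_Iic_timeDiff]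
    _ = ∑ j, ∑ l ∈ Finset.Ici j, ω l * timeDiff m t j :=
        Finset.sum_comm' (by simp)
    _ = _ := Finset.sum_congr rfl fun j _ => by rw [Finset.sum_mul]

/-- The time integral, against a test function, of the diagram `σ` with the two-point functions
given by the energy densities `r i`, without the powers of `ε`. -/
noncomputable def cycleIntegral (σ : Equiv.Perm (Fin (m + 1))) (r : Fin (m + 1) → ℝ → ℂ)
    (ω : Fin (m + 1) → ℝ) (φ : (Fin (m + 1) → ℝ) → ℂ) (ε : ℝ) : ℂ :=
  ∫ t : Fin (m + 1) → ℝ, Complex.exp (-(Complex.I * ∑ l, (ω l : ℂ) * t l / ε)) *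
    (∏ i, ∫ E : ℝ, r i E * Complex.exp (Complex.I * ((t i - t (σ i)) / ε : ℝ) * E)) * φ t

theorem tendsto_cycleIntegral_outerDiagram {r : Fin (m + 1) → ℝ → ℂ}
    (hr : ∀ i, Integrable (r i)) (hr' : ∀ i, MemLp (r i) ((m + 1 : ℕ) : ENNReal) volume)
    (ω : Fin (m + 1) → ℝ) (φ : 𝓢(Fin (m + 1) → ℝ, ℂ)) :
    Tendsto (fun ε : ℝ => ((ε : ℂ)⁻¹) ^ m * cycleIntegral (outerDiagram (m + 1)) r ω φ ε) (𝓝[>] 0)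
      (𝓝 ((2 * Real.pi : ℂ) ^ m * (if ∑ l ∈ Finset.Ici 0, ω l = 0 then 1 else 0) *
        (∫ E : ℝ, ∏ i, r i (E + (Matrix.vecCons 0 (fun l : Fin m => ∑ k ∈ Finset.Ici l.succ, ω k) :
          Fin (m + 1) → ℝ) i)) * ∫ t : ℝ, φ fun _ => t)) := by
  set a := ∑ l ∈ Finset.Ici 0, ω l with ha
  set c : Fin m → ℝ := fun l => ∑ k ∈ Finset.Ici l.succ, ω k with hc
  let φ' : 𝓢(Fin (m + 1) → ℝ, ℂ) :=
    SchwartzMap.compCLMOfContinuousLinearEquiv ℝ (timeDiffEquiv m).symm φ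
  have hφ' : ∀ t, φ' (timeDiff m t) = φ t := fun t => by
    rw [← timeDiffEquiv_apply]
    exact congrArg φ ((timeDiffEquiv m).symm_apply_apply t)
  let G : (Fin m → ℝ) → ℂ := fun v =>
    ∫ E : ℝ, ∏ i, r i (E + (Matrix.vecCons 0 (c + v) : Fin (m + 1) → ℝ) i)
  have hG : Continuous G :=
    (continuous_integral_prod_translate hr').comp (by fun_prop)
  have h := tendsto_integral_mul_piFourier φ' a hG
    (fun v => norm_integral_prod_translate_le hr' _)
  have hdiag : ∀ x : ℝ, φ' (Matrix.vecCons x 0) = φ fun _ => x := by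
    intro x
    rw [← hφ' fun _ => x]
    congr 1
    ext i
    induction i using Fin.cases <;> simp
  simp only [hdiag] at h
  have hG0 : G 0 = ∫ E : ℝ, ∏ i, r i (E + (Matrix.vecCons 0 c : Fin (m + 1) → ℝ) i) := by
    simp [G]
  rw [hG0] at h
  refine h.congr' ?_
  filter_upwards [self_mem_nhdsWithin] with ε hε
  rw [Set.mem_Ioi] at hε
  congr 1
  rw [← integral_cyclic_eq hr φ' a c hε, cycleIntegral,
    ← measurePreserving_timeDiff.integral_comp
      (timeDiffEquiv m).toHomeomorph.measurableEmbedding]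
  refine integral_congr_ae (ae_of_all _ fun t => ?_)
  simp only
  rw [hφ', ← mul_assoc]
  congr 1
  rw [mul_comm]
  congr 1
  · congr 2
    have h1 := sum_mul_eq_sum_timeDiff ω t
    rw [Fin.sum_univ_succ (f := fun j => _ * timeDiff m t j)] at h1
    rw [← ha] at h1
    rw [← h1, mul_div_assoc, ← Finset.sum_div]
    push_cast
    rfl
  · refine Finset.prod_congr rfl fun i _ => ?_
    have : ((Matrix.vecCons (-(∑ l : Fin m, timeDiff m t l.succ) / ε)
        (fun l : Fin m => timeDiff m t l.succ / ε) : Fin (m + 1) → ℝ) i)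
        = (t i - t (outerDiagram (m + 1) i)) / ε := by
      induction i using Fin.cases with
      | zero =>
        rw [Matrix.cons_val_zero, sum_timeDiff_succ, outerDiagram_zero]
        ring
      | succ l => rw [Matrix.cons_val_succ, outerDiagram_succ, timeDiff_succ]
    rw [this]

theorem IsIrreducibleDiagram.sameCycle {σ : Equiv.Perm (Fin (m + 1))}
    (h : IsIrreducibleDiagram σ) (i j : Fin (m + 1)) : σ.SameCycle i j := by
  classical
  by_contra hij
  refine h ⟨Finset.univ.filter fun k => σ.SameCycle i k,
    ⟨i, by simp [Equiv.Perm.SameCycle.refl]⟩, fun he => hij ?_, fun k => ?_⟩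
  · simpa using Finset.eq_univ_iff_forall.1 he j
  · simp

theorem IsIrreducibleDiagram.support_eq {σ : Equiv.Perm (Fin (m + 1 + 1))}
    (h : IsIrreducibleDiagram σ) : σ.support = Finset.univ := by
  refine Finset.eq_univ_iff_forall.2 fun i => Equiv.Perm.mem_support.2 fun hi => ?_
  obtain ⟨j, hj⟩ := exists_ne i
  exact hj ((h.sameCycle i j).eq_of_left hi).symm

theorem IsIrreducibleDiagram.isCycle {σ : Equiv.Perm (Fin (m + 1 + 1))}
    (h : IsIrreducibleDiagram σ) : σ.IsCycle :=
  ⟨0, Equiv.Perm.mem_support.1 (by rw [h.support_eq]; exact Finset.mem_univ _),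
    fun j _ => h.sameCycle 0 j⟩

/-- All irreducible diagrams are cyclic, hence conjugate to the outer diagram. -/
theorem IsIrreducibleDiagram.exists_conj {σ : Equiv.Perm (Fin (m + 1))}
    (h : IsIrreducibleDiagram σ) :
    ∃ τ : Equiv.Perm (Fin (m + 1)), ∀ j, σ (τ j) = τ (outerDiagram (m + 1) j) := by
  cases m with
  | zero => exact ⟨1, fun j => Subsingleton.elim (α := Fin 1) _ _⟩
  | succ m =>
    have h' := isIrreducibleDiagram_outerDiagram (m := m + 1)
    obtain ⟨τ, hτ⟩ := isConj_iff.1 (h'.isCycle.isConj h.isCycle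
      (by rw [h.support_eq, h'.support_eq]))
    exact ⟨τ, fun j => by rw [← hτ]; simp⟩

theorem exists_tendsto_cycleIntegral {σ : Equiv.Perm (Fin (m + 1))}
    (hσ : IsIrreducibleDiagram σ) {r : Fin (m + 1) → ℝ → ℂ}
    (hr : ∀ i, Integrable (r i)) (hr' : ∀ i, MemLp (r i) ((m + 1 : ℕ) : ENNReal) volume)
    (ω : Fin (m + 1) → ℝ) (φ : 𝓢(Fin (m + 1) → ℝ, ℂ)) :
    ∃ L, Tendsto (fun ε : ℝ => ((ε : ℂ)⁻¹) ^ m * cycleIntegral σ r ω φ ε) (𝓝[>] 0) (𝓝 L) := by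
  obtain ⟨τ, hτ⟩ := hσ.exists_conj
  let e : (Fin (m + 1) → ℝ) ≃L[ℝ] (Fin (m + 1) → ℝ) :=
    ContinuousLinearEquiv.piCongrLeft ℝ (fun _ => ℝ) τ
  have he : ∀ (s : Fin (m + 1) → ℝ) j, e s (τ j) = s j := fun s j =>
    Equiv.piCongrLeft_apply_apply (fun _ => ℝ) τ s j
  let φ' : 𝓢(Fin (m + 1) → ℝ, ℂ) := SchwartzMap.compCLMOfContinuousLinearEquiv ℝ e φ
  refine ⟨_, (tendsto_cycleIntegral_outerDiagram (r := fun j => r (τ j)) (fun j => hr _)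
    (fun j => hr' _) (fun j => ω (τ j)) φ').congr fun ε => ?_⟩
  congr 1
  refine Eq.trans ?_ ((volume_measurePreserving_piCongrLeft (fun _ => ℝ) τ).integral_comp
    (MeasurableEquiv.measurableEmbedding _) _)
  refine integral_congr_ae (ae_of_all _ fun s => ?_)
  change _ = Complex.exp (-(Complex.I * ∑ l, (ω l : ℂ) * (e s l : ℂ) / ε)) *
    (∏ i, ∫ E : ℝ, r i E * Complex.exp (Complex.I * ((e s i - e s (σ i)) / ε : ℝ) * E)) * φ (e s)
  rw [← Equiv.sum_comp τ (fun l => (ω l : ℂ) * (e s l : ℂ) / ε), ← Equiv.prod_comp τ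
    (fun i => ∫ E : ℝ, r i E * Complex.exp (Complex.I * ((e s i - e s (σ i)) / ε : ℝ) * E))]
  simp only [hτ, he]
  rfl

end Cyclic

/-! ### The limits of the diagrams -/

section Diagrams

variable {H : Type*} [NormedAddCommGroup H] [InnerProductSpace ℂ H]

theorem gaussianState_creation_mul_annihilation (n : H →L[ℂ] H) (f g : H) :
    gaussianState n (creation f * annihilation g) = inner ℂ g (n f) := by
  have h := gaussianState_prod n [Ladder.create f, Ladder.annihilate g]
  simpa [wick_cons, wick_nil, pick, twoPoint, creation, annihilation] using h

theorem gaussianState_annihilation_mul_creation (n : H →L[ℂ] H) (f g : H) :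
    gaussianState n (annihilation g * creation f) = inner ℂ g f + inner ℂ g (n f) := by
  have h := gaussianState_prod n [Ladder.annihilate g, Ladder.create f]
  simpa [wick_cons, wick_nil, pick, twoPoint, creation, annihilation] using h

/-- The Fourier integral of an integrable function is continuous. -/
theorem continuous_integral_mul_exp {r : ℝ → ℂ} (hr : Integrable r) :
    Continuous fun s : ℝ => ∫ E : ℝ, r E * Complex.exp (Complex.I * s * E) := by
  refine continuous_of_dominated (bound := fun E => ‖r E‖) (fun s => ?_)
    (fun s => ae_of_all _ fun E => ?_) hr.norm (ae_of_all _ fun E => by fun_prop)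
  · exact hr.1.mul (Continuous.aestronglyMeasurable (by fun_prop))
  · rw [norm_mul, Complex.norm_exp]
    simp

theorem norm_integral_mul_exp_le (r : ℝ → ℂ) (s : ℝ) :
    ‖∫ E : ℝ, r E * Complex.exp (Complex.I * s * E)‖ ≤ ∫ E, ‖r E‖ := by
  refine (norm_integral_le_integral_norm _).trans (le_of_eq ?_)
  refine integral_congr_ae (ae_of_all _ fun E => ?_)
  simp [Complex.norm_exp]

variable {m : ℕ}

theorem integrable_cycleIntegrand (σ : Equiv.Perm (Fin (m + 1))) {r : Fin (m + 1) → ℝ → ℂ}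
    (hr : ∀ i, Integrable (r i)) (ω : Fin (m + 1) → ℝ) (φ : 𝓢(Fin (m + 1) → ℝ, ℂ)) (ε : ℝ) :
    Integrable fun t : Fin (m + 1) → ℝ => Complex.exp (-(Complex.I * ∑ l, (ω l : ℂ) * t l / ε)) *
      (∏ i, ∫ E : ℝ, r i E * Complex.exp (Complex.I * ((t i - t (σ i)) / ε : ℝ) * E)) * φ t := by
  refine φ.integrable.bdd_mul (c := ∏ i, ∫ E, ‖r i E‖) (Continuous.aestronglyMeasurable ?_)
    (ae_of_all _ fun t => ?_)
  · refine Continuous.mul (by fun_prop) (continuous_finsetProd _ fun i _ => ?_)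
    exact (continuous_integral_mul_exp (hr i)).comp (g := fun s : ℝ => _)
      (f := fun t : Fin (m + 1) → ℝ => (t i - t (σ i)) / ε) (by fun_prop)
  · rw [norm_mul, norm_prod]
    have h1 : ‖Complex.exp (-(Complex.I * ∑ l, (ω l : ℂ) * t l / ε))‖ = 1 := by
      have : -(Complex.I * ∑ l, (ω l : ℂ) * t l / ε)
          = ((-(∑ l, ω l * t l / ε) : ℝ) : ℂ) * Complex.I := by
        push_cast; ring
      rw [this, Complex.norm_exp_ofReal_mul_I]
    rw [h1, one_mul]
    exact Finset.prod_le_prod (fun _ _ => norm_nonneg _)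
      fun i _ => norm_integral_mul_exp_le (r i) _

/-- The indices `i` for which the two-point function of `A⁺_i` and its partner `A_{σ i}` has a
term of order `ε⁻¹`. -/
def descents (σ : Equiv.Perm (Fin (m + 1))) : Finset (Fin (m + 1)) :=
  Finset.univ.filter fun i => σ i < i

/-- The energy densities of the pairs of the diagram `σ` when the terms of order `ε⁻¹` are chosen
for the indices in `D`. -/
def pairDensity (p q : Fin (m + 1) → Fin (m + 1) → ℝ → ℂ) (σ : Equiv.Perm (Fin (m + 1)))
    (D : Finset (Fin (m + 1))) (i : Fin (m + 1)) : ℝ → ℂ :=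
  if i ∈ D then p (σ i) i else q (σ i) i

theorem descents_outerDiagram : descents (outerDiagram (m + 1)) = Finset.univ.erase 0 := by
  ext i
  induction i using Fin.cases with
  | zero => simp [descents]
  | succ l => simp [descents, outerDiagram_succ]

/-- The functions `p j i`, for `j < i`, and `q j i` are the energy densities `E ↦ ⟨g_j, P_E f_i⟩`
and `E ↦ ⟨g_j, P_E n f_i⟩`, and they are in `L^{m+1}`. -/
structure HasEnergyDensities (S : ℝ → H →L[ℂ] H) (n : H →L[ℂ] H) (f g : Fin (m + 1) → H)
    (p q : Fin (m + 1) → Fin (m + 1) → ℝ → ℂ) : Prop where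
  left : ∀ j i, j < i → IsEnergyDensity S (g j) (f i) (p j i) ∧
    MemLp (p j i) ((m + 1 : ℕ) : ENNReal) volume
  right : ∀ j i, IsEnergyDensity S (g j) (n (f i)) (q j i) ∧
    MemLp (q j i) ((m + 1 : ℕ) : ENNReal) volume

variable {S : ℝ → H →L[ℂ] H} {n : H →L[ℂ] H} {f g : Fin (m + 1) → H}
  {p q : Fin (m + 1) → Fin (m + 1) → ℝ → ℂ}

theorem pairDensity_mem
    (hpq : HasEnergyDensities S n f g p q)
    {σ : Equiv.Perm (Fin (m + 1))} {D : Finset (Fin (m + 1))} (hD : D ⊆ descents σ)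
    (i : Fin (m + 1)) :
    Integrable (pairDensity p q σ D i) ∧
      MemLp (pairDensity p q σ D i) ((m + 1 : ℕ) : ENNReal) volume := by
  rw [pairDensity]
  split_ifs with hi
  · have := hpq.left _ _ (Finset.mem_filter.1 (hD hi)).2
    exact ⟨this.1.1, this.2⟩
  · exact ⟨(hpq.right _ _).1.1, (hpq.right _ _).2⟩

theorem zero_notMem_descents (σ : Equiv.Perm (Fin (m + 1))) : (0 : Fin (m + 1)) ∉ descents σ := by
  simp [descents]

theorem subset_erase_zero {σ : Equiv.Perm (Fin (m + 1))} {D : Finset (Fin (m + 1))}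
    (hD : D ⊆ descents σ) : D ⊆ Finset.univ.erase 0 := fun _ hi =>
  Finset.mem_erase.2 ⟨fun h => zero_notMem_descents σ (h ▸ hD hi), Finset.mem_univ _⟩

/-- A term with fewer than `m` factors `ε⁻¹` vanishes in the limit: the time integral of an
irreducible diagram is of the order `ε ^ m`. -/
theorem tendsto_term_zero
    (hpq : HasEnergyDensities S n f g p q)
    (ω : Fin (m + 1) → ℝ) {σ : Equiv.Perm (Fin (m + 1))} (hσ : IsIrreducibleDiagram σ)
    {D : Finset (Fin (m + 1))} (hD : D ⊆ descents σ) (hne : D ≠ Finset.univ.erase 0)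
    (φ : 𝓢(Fin (m + 1) → ℝ, ℂ)) :
    Tendsto (fun ε : ℝ => ((ε : ℂ)⁻¹) ^ D.card *
      cycleIntegral σ (pairDensity p q σ D) ω φ ε) (𝓝[>] 0) (𝓝 0) := by
  have hcard : D.card < m := by
    have := Finset.card_lt_card (Finset.ssubset_iff_subset_ne.2 ⟨subset_erase_zero hD, hne⟩)
    simpa using this
  obtain ⟨L, hL⟩ := exists_tendsto_cycleIntegral hσ
    (fun i => (pairDensity_mem hpq hD i).1) (fun i => (pairDensity_mem hpq hD i).2) ω φ
  have hpow : Tendsto (fun ε : ℝ => (ε : ℂ) ^ (m - D.card)) (𝓝[>] 0) (𝓝 0) := by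
    have hc : Continuous fun ε : ℝ => (ε : ℂ) ^ (m - D.card) := by fun_prop
    have := hc.tendsto 0
    rw [Complex.ofReal_zero, zero_pow (Nat.sub_ne_zero_of_lt hcard)] at this
    exact this.mono_left nhdsWithin_le_nhds
  have := hpow.mul hL
  rw [zero_mul] at this
  refine this.congr' ?_
  filter_upwards [self_mem_nhdsWithin] with ε hε
  have hε' : (ε : ℂ) ≠ 0 := by exact_mod_cast (Set.mem_Ioi.1 hε).ne'
  rw [← mul_assoc]
  congr 1
  have hsplit : ((ε : ℂ)⁻¹) ^ m = ((ε : ℂ)⁻¹) ^ (m - D.card) * ((ε : ℂ)⁻¹) ^ D.card := by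
    rw [← pow_add, Nat.sub_add_cancel hcard.le]
  rw [hsplit, ← mul_assoc, ← mul_pow, mul_inv_cancel₀ hε', one_pow, one_mul]

theorem integrable_limit_density
    (hpq : HasEnergyDensities S n f g p q) (c : Fin m → ℝ) :
    Integrable fun E => q (Fin.last m) 0 E * ∏ l : Fin m, p l.castSucc l.succ (E + c l) := by
  have h := integrable_prod_of_memLp (m := m)
    (r := Fin.cons (q (Fin.last m) 0) fun l E => p l.castSucc l.succ (E + c l)) fun i => by
      induction i using Fin.cases with
      | zero => exact (hpq.right _ _).2
      | succ l => exact memLp_translate (hpq.left _ _ Fin.castSucc_lt_succ).2 _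
  simpa [Fin.prod_univ_succ] using h

variable [CompleteSpace H]

theorem IsUnitaryGroup.inner_map_map (hS : IsUnitaryGroup S) (s t : ℝ)
    (x y : H) : inner ℂ (S s x) (S t y) = inner ℂ x (S (t - s) y) := by
  have h : S t y = S s (S (t - s) y) := by
    rw [← ContinuousLinearMap.comp_apply, ← hS.map_add, add_sub_cancel]
  rw [h, ← ContinuousLinearMap.adjoint_inner_right, ← ContinuousLinearMap.comp_apply]
  have h2 := Unitary.star_mul_self_of_mem (hS.mem_unitary s)
  rw [ContinuousLinearMap.star_eq_adjoint] at h2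
  change inner ℂ x ((ContinuousLinearMap.adjoint (S s) * S s) _) = _
  rw [h2]
  rfl

theorem IsUnitaryGroup.map_zero (hS : IsUnitaryGroup S) : S 0 = 1 := by
  have h1 : S 0 * S 0 = S 0 := by
    have := hS.map_add 0 0
    rw [add_zero] at this
    exact this.symm
  have h2 := Unitary.star_mul_self_of_mem (hS.mem_unitary 0)
  calc S 0 = star (S 0) * S 0 * S 0 := by rw [h2, one_mul]
    _ = 1 := by rw [mul_assoc, h1, h2]

theorem IsUnitaryGroup.comm_apply (hS : IsUnitaryGroup S)
    (hSn : ∀ t, S (-t) ∘L n ∘L S t = n) (t : ℝ) (x : H) : n (S t x) = S t (n x) := by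
  have h : S t (S (-t) (n (S t x))) = S t (n x) := by
    have := congrArg (fun T : H →L[ℂ] H => S t (T x)) (hSn t)
    exact this
  rw [← h, ← ContinuousLinearMap.comp_apply (S t), ← hS.map_add, add_neg_cancel, hS.map_zero]
  rfl

/-- The two-point functions of the rescaled operators: the term of order `ε⁻¹` is present only
when the annihilation operator stands to the left of the creation operator. -/
theorem pairing_eq (hS : IsUnitaryGroup S)
    (hSn : ∀ t, S (-t) ∘L n ∘L S t = n) {N : ℕ} (f g : Fin N → H) {ε : ℝ} (hε : 0 < ε)
    (t : Fin N → ℝ) (i j : Fin N) :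
    pairing S n f g ε t i j =
      (if j < i then (ε : ℂ)⁻¹ * inner ℂ (g j) (S ((t i - t j) / ε) (f i)) else 0) +
        inner ℂ (g j) (S ((t i - t j) / ε) (n (f i))) := by
  have hs : ((Real.sqrt ε : ℂ)⁻¹) * ((Real.sqrt ε : ℂ)⁻¹) = (ε : ℂ)⁻¹ := by
    rw [← mul_inv, ← Complex.ofReal_mul, Real.mul_self_sqrt hε.le]
  have hε' : (ε : ℂ) ≠ 0 := by exact_mod_cast hε.ne'
  have h1 : ∀ x : H, inner ℂ (S (t j / ε) (g j)) (S (t i / ε) x)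
      = inner ℂ (g j) (S ((t i - t j) / ε) x) := fun x => by
    rw [hS.inner_map_map, sub_div]
  rw [pairing]
  by_cases hij : i ≤ j
  · rw [if_pos hij, if_neg (not_lt.2 hij)]
    simp only [smul_mul_smul_comm, hs, map_smul, gaussianState_creation_mul_annihilation,
      smul_apply, inner_smul_right, smul_eq_mul]
    rw [hS.comm_apply hSn, h1, inv_mul_cancel_left₀ hε', zero_add]
  · rw [if_neg hij, if_pos (not_le.1 hij)]
    simp only [smul_mul_smul_comm, hs, map_smul, gaussianState_annihilation_mul_creation,
      smul_apply, inner_smul_right, smul_eq_mul]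
    rw [hS.comm_apply hSn, h1, h1, mul_add, inv_mul_cancel_left₀ hε']

/-- Expansion of a diagram in powers of `ε⁻¹`. -/
theorem diagram_eq_sum (hS : IsUnitaryGroup S) (hSn : ∀ t, S (-t) ∘L n ∘L S t = n)
    (hpq : HasEnergyDensities S n f g p q)
    (ω : Fin (m + 1) → ℝ) {ε : ℝ} (hε : 0 < ε) (t : Fin (m + 1) → ℝ)
    (σ : Equiv.Perm (Fin (m + 1))) :
    diagram S n f g ω ε t σ = ∑ D ∈ (descents σ).powerset, ((ε : ℂ)⁻¹) ^ D.card *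
      (Complex.exp (-(Complex.I * ∑ l, (ω l : ℂ) * t l / ε)) *
        ∏ i, ∫ E : ℝ, pairDensity p q σ D i E *
          Complex.exp (Complex.I * ((t i - t (σ i)) / ε : ℝ) * E)) := by
  rw [diagram]
  simp only [pairing_eq hS hSn f g hε]
  rw [Finset.prod_add, Finset.mul_sum]
  symm
  refine Finset.sum_subset_zero_on_sdiff (Finset.powerset_mono.2 (Finset.subset_univ _)) ?_ ?_
  · intro D hD
    rw [Finset.mem_sdiff, Finset.mem_powerset, Finset.mem_powerset] at hD
    obtain ⟨i, hi, hi'⟩ := Finset.not_subset.1 hD.2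
    rw [Finset.prod_eq_zero hi, zero_mul, mul_zero]
    rw [if_neg]
    intro h
    exact hi' (Finset.mem_filter.2 ⟨Finset.mem_univ _, h⟩)
  · intro D hD
    rw [Finset.mem_powerset] at hD
    rw [← Finset.prod_sdiff (Finset.subset_univ D)]
    have h1 : ∏ i ∈ D, (if σ i < i then
          (ε : ℂ)⁻¹ * inner ℂ (g (σ i)) (S ((t i - t (σ i)) / ε) (f i)) else 0)
        = ((ε : ℂ)⁻¹) ^ D.card * ∏ i ∈ D, ∫ E : ℝ, pairDensity p q σ D i E *
          Complex.exp (Complex.I * ((t i - t (σ i)) / ε : ℝ) * E) := by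
      rw [← Finset.prod_const, ← Finset.prod_mul_distrib]
      refine Finset.prod_congr rfl fun i hi => ?_
      have hlt := (Finset.mem_filter.1 (hD hi)).2
      rw [if_pos hlt, (hpq.left _ _ hlt).1.inner_eq_integral hS, pairDensity, if_pos hi]
    have h2 : ∏ i ∈ Finset.univ \ D, inner ℂ (g (σ i)) (S ((t i - t (σ i)) / ε) (n (f i)))
        = ∏ i ∈ Finset.univ \ D, ∫ E : ℝ, pairDensity p q σ D i E *
          Complex.exp (Complex.I * ((t i - t (σ i)) / ε : ℝ) * E) := by
      refine Finset.prod_congr rfl fun i hi => ?_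
      rw [(hpq.right _ _).1.inner_eq_integral hS, pairDensity, if_neg (Finset.mem_sdiff.1 hi).2]
    rw [h1, h2]
    ring

theorem integrable_diagram_mul (hS : IsUnitaryGroup S) (hSn : ∀ t, S (-t) ∘L n ∘L S t = n)
    (hpq : HasEnergyDensities S n f g p q)
    (ω : Fin (m + 1) → ℝ) {ε : ℝ} (hε : 0 < ε) (σ : Equiv.Perm (Fin (m + 1)))
    (φ : 𝓢(Fin (m + 1) → ℝ, ℂ)) :
    Integrable fun t => diagram S n f g ω ε t σ * φ t := by
  simp only [diagram_eq_sum hS hSn hpq ω hε, Finset.sum_mul, mul_assoc]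
  refine integrable_finsetSum _ fun D hD => Integrable.const_mul ?_ _
  have := integrable_cycleIntegrand σ
    (fun i => (pairDensity_mem hpq (Finset.mem_powerset.1 hD) i).1) ω φ ε
  simpa only [mul_assoc] using this

theorem integral_diagram_mul (hS : IsUnitaryGroup S) (hSn : ∀ t, S (-t) ∘L n ∘L S t = n)
    (hpq : HasEnergyDensities S n f g p q)
    (ω : Fin (m + 1) → ℝ) {ε : ℝ} (hε : 0 < ε) (σ : Equiv.Perm (Fin (m + 1)))
    (φ : 𝓢(Fin (m + 1) → ℝ, ℂ)) :
    ∫ t, diagram S n f g ω ε t σ * φ t = ∑ D ∈ (descents σ).powerset, ((ε : ℂ)⁻¹) ^ D.card *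
      cycleIntegral σ (pairDensity p q σ D) ω φ ε := by
  simp only [diagram_eq_sum hS hSn hpq ω hε, Finset.sum_mul]
  have hi : ∀ D ∈ (descents σ).powerset, Integrable fun t : Fin (m + 1) → ℝ =>
      Complex.exp (-(Complex.I * ∑ l, (ω l : ℂ) * t l / ε)) *
        (∏ i, ∫ E : ℝ, pairDensity p q σ D i E *
          Complex.exp (Complex.I * ((t i - t (σ i)) / ε : ℝ) * E)) * φ t := fun D hD =>
    integrable_cycleIntegrand σ
      (fun i => (pairDensity_mem hpq (Finset.mem_powerset.1 hD) i).1) ω φ ε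
  rw [integral_finsetSum]
  · refine Finset.sum_congr rfl fun D _ => ?_
    rw [cycleIntegral, ← integral_const_mul]
    exact integral_congr_ae (ae_of_all _ fun t => by simp only [mul_assoc])
  · intro D hD
    simpa only [mul_assoc] using (hi D hD).const_mul (((ε : ℂ)⁻¹) ^ D.card)

theorem tendsto_diagram_zero (hS : IsUnitaryGroup S) (hSn : ∀ t, S (-t) ∘L n ∘L S t = n)
    (hpq : HasEnergyDensities S n f g p q)
    (ω : Fin (m + 1) → ℝ) {σ : Equiv.Perm (Fin (m + 1))} (hσ : IsIrreducibleDiagram σ)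
    (hne : σ ≠ outerDiagram (m + 1)) (φ : 𝓢(Fin (m + 1) → ℝ, ℂ)) :
    Tendsto (fun ε : ℝ => ∫ t, diagram S n f g ω ε t σ * φ t) (𝓝[>] 0) (𝓝 0) := by
  have hD : ∀ D ∈ (descents σ).powerset, D ≠ Finset.univ.erase 0 := by
    rintro D hD rfl
    refine hne (eq_outerDiagram_of_lt σ fun i hi => ?_)
    exact (Finset.mem_filter.1 (Finset.mem_powerset.1 hD
      (Finset.mem_erase.2 ⟨hi, Finset.mem_univ _⟩))).2
  have h := tendsto_finsetSum _ fun D hD' =>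
    tendsto_term_zero hpq ω hσ (Finset.mem_powerset.1 hD') (hD D hD') φ
  rw [Finset.sum_const_zero] at h
  refine h.congr' ?_
  filter_upwards [self_mem_nhdsWithin] with ε hε
  exact (integral_diagram_mul hS hSn hpq ω hε σ φ).symm

theorem tendsto_diagram_outerDiagram (hS : IsUnitaryGroup S)
    (hSn : ∀ t, S (-t) ∘L n ∘L S t = n)
    (hpq : HasEnergyDensities S n f g p q)
    (ω : Fin (m + 1) → ℝ) (φ : 𝓢(Fin (m + 1) → ℝ, ℂ)) :
    Tendsto (fun ε : ℝ => ∫ t, diagram S n f g ω ε t (outerDiagram (m + 1)) * φ t) (𝓝[>] 0)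
      (𝓝 ((2 * Real.pi : ℂ) ^ m * (if ∑ l ∈ Finset.Ici 0, ω l = 0 then 1 else 0) *
        (∫ E, q (Fin.last m) 0 E *
          ∏ l : Fin m, p l.castSucc l.succ (E + ∑ k ∈ Finset.Ici l.succ, ω k)) *
        ∫ t : ℝ, φ fun _ => t)) := by
  set σ := outerDiagram (m + 1) with hσ
  set D₀ : Finset (Fin (m + 1)) := Finset.univ.erase 0 with hD₀
  have hsub : D₀ ⊆ descents σ := by rw [hσ, descents_outerDiagram]
  have hlead := tendsto_cycleIntegral_outerDiagram
    (fun i => (pairDensity_mem hpq hsub i).1) (fun i => (pairDensity_mem hpq hsub i).2) ω φ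
  have hdens : ∀ E : ℝ, ∏ i, pairDensity p q σ D₀ i (E +
        (Matrix.vecCons 0 (fun l : Fin m => ∑ k ∈ Finset.Ici l.succ, ω k) :
          Fin (m + 1) → ℝ) i)
      = q (Fin.last m) 0 E *
          ∏ l : Fin m, p l.castSucc l.succ (E + ∑ k ∈ Finset.Ici l.succ, ω k) := by
    intro E
    simp [Fin.prod_univ_succ, pairDensity, hD₀, hσ, outerDiagram_zero, outerDiagram_succ]
  simp only [hdens] at hlead
  set L := (2 * Real.pi : ℂ) ^ m * (if ∑ l ∈ Finset.Ici 0, ω l = 0 then 1 else 0) *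
        (∫ E, q (Fin.last m) 0 E *
          ∏ l : Fin m, p l.castSucc l.succ (E + ∑ k ∈ Finset.Ici l.succ, ω k)) *
        ∫ t : ℝ, φ fun _ => t with hL
  have h := tendsto_finsetSum (descents σ).powerset (a := fun D => if D = D₀ then L else 0)
    (f := fun D (ε : ℝ) => ((ε : ℂ)⁻¹) ^ D.card * cycleIntegral σ (pairDensity p q σ D) ω φ ε)
    (x := 𝓝[>] 0) fun D hD => by
      by_cases hDD : D = D₀
      · have hc : D₀.card = m := by simp [hD₀]
        simp only [hDD, if_true, hc]
        exact hlead
      · simp only [if_neg hDD]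
        exact tendsto_term_zero hpq ω isIrreducibleDiagram_outerDiagram
          (Finset.mem_powerset.1 hD) hDD φ
  rw [Finset.sum_ite_eq', if_pos (Finset.mem_powerset.2 hsub)] at h
  refine h.congr' ?_
  filter_upwards [self_mem_nhdsWithin] with ε hε
  exact (integral_diagram_mul hS hSn hpq ω hε σ φ).symm

end Diagrams

/-! ### Wick's formula as a sum over permutations -/

section WickPermanent

variable {X Y : Type*}

theorem wick_congr_of_pairwise {c c' : X → X → ℂ} (l : List X)
    (h : l.Pairwise fun x y => c x y = c' x y) : wick c l = wick c' l := by
  induction hn : l.length using Nat.strong_induction_on generalizing l with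
  | _ n ih =>
    subst hn
    cases l with
    | nil => rw [wick_nil, wick_nil]
    | cons x l =>
      rw [wick, wick]
      rw [List.pairwise_cons] at h
      refine Finset.sum_congr rfl fun k _ => ?_
      have hx : c x l[k] = c' x l[k] := h.1 _ (List.getElem_mem _)
      rw [hx, ih _ ?_ _ (h.2.sublist (List.eraseIdx_sublist _ _)) rfl]
      have := List.length_eraseIdx_of_lt k.isLt
      simp only [List.length_cons]
      omega

theorem wick_map (c : X → X → ℂ) (F : Y → X) (l : List Y) :
    wick c (l.map F) = wick (fun x y => c (F x) (F y)) l := by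
  induction hn : l.length using Nat.strong_induction_on generalizing l with
  | _ n ih =>
    subst hn
    cases l with
    | nil => rw [List.map_nil, wick_nil, wick_nil]
    | cons x l =>
      rw [List.map_cons, wick, wick]
      refine Fintype.sum_equiv (finCongr (List.length_map F)) _ _ fun k => ?_
      have hk : (k : ℕ) < l.length := by simpa using k.isLt
      have hlt : (l.eraseIdx k).length < (x :: l).length := by
        have := List.length_eraseIdx_of_lt hk
        simp only [List.length_cons]
        omega
      have hw := ih _ hlt (l.eraseIdx k) rfl
      simp only [finCongr_apply, Fin.val_cast, Fin.getElem_fin, List.getElem_map,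
        List.eraseIdx_map, hw]

/-- For a symmetric two-point function the order of the letters does not matter. -/
theorem wick_perm {c : X → X → ℂ} (hc : ∀ x y, c x y = c y x) {l l' : List X}
    (h : l.Perm l') : wick c l = wick c l' := by
  suffices ∀ u, wick c (u ++ l) = wick c (u ++ l') from this []
  induction h with
  | nil => exact fun _ => rfl
  | cons x _ ih =>
    intro u
    simpa using ih (u ++ [x])
  | swap x y l =>
    intro u
    rw [wick_swap c y x 0 (by rw [hc, add_zero]), zero_mul, add_zero]
  | trans _ _ ih1 ih2 => exact fun u => (ih1 u).trans (ih2 u)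

theorem eraseIdx_ofFn_perm {k : ℕ} (b : Fin (k + 1) → X) (p : Fin (k + 1)) :
    ((List.ofFn b).eraseIdx p).Perm
      (List.ofFn fun i : Fin k => b (Equiv.swap 0 p i.succ)) := by
  have h1 : (List.ofFn b).Perm (b p :: (List.ofFn b).eraseIdx p) := by
    have := List.getElem_cons_eraseIdx_perm (l := List.ofFn b) (n := p)
      (by simp [Nat.lt_succ_iff.1 p.isLt])
    rw [List.getElem_ofFn] at this
    exact this.symm
  have h2 : (List.ofFn (b ∘ Equiv.swap 0 p)).Perm (List.ofFn b) :=
    Equiv.Perm.ofFn_comp_perm _ _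
  rw [List.ofFn_succ] at h2
  simp only [Function.comp_apply, Equiv.swap_apply_left] at h2
  exact (List.perm_cons _).1 (h2.trans h1).symm

/-- With a symmetric two-point function that vanishes on the pairs of letters `a i`, `a j`, the
pairings of the word `a₁ ⋯ aₖ b₁ ⋯ bₖ` are given by the permutations. -/
theorem wick_ofFn_append {c : X → X → ℂ} (hc : ∀ x y, c x y = c y x) {k : ℕ}
    (a b : Fin k → X) (ha : ∀ i j, c (a i) (a j) = 0) :
    wick c (List.ofFn a ++ List.ofFn b)
      = ∑ σ : Equiv.Perm (Fin k), ∏ i, c (a i) (b (σ i)) := by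
  induction k with
  | zero => simp [wick_nil]
  | succ k ih =>
    rw [List.ofFn_succ (f := a), List.cons_append, wick_cons, pick_append]
    have h0 : pick (fun x r => c (a 0) x * wick c (r ++ List.ofFn b))
        (List.ofFn fun i => a i.succ) = 0 := by
      rw [← sum_eq_pick (fun x r => c (a 0) x * wick c (r ++ List.ofFn b))]
      refine Finset.sum_eq_zero fun j _ => ?_
      simp [ha]
    rw [h0, zero_add, ← sum_eq_pick
      (fun x r => c (a 0) x * wick c ((List.ofFn fun i => a i.succ) ++ r)),
      ← Equiv.Perm.decomposeFin.symm.sum_comp, Fintype.sum_prod_type]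
    refine Fintype.sum_equiv (finCongr List.length_ofFn) _ _ fun p => ?_
    have hp := wick_perm hc ((eraseIdx_ofFn_perm b (finCongr List.length_ofFn p)).append_left
      (List.ofFn fun i => a i.succ))
    simp only [finCongr_apply, Fin.val_cast] at hp
    simp only [finCongr_apply, Fin.getElem_fin]
    have hb : (List.ofFn b)[(p : ℕ)] = b (Fin.cast List.length_ofFn p) := by
      rw [List.getElem_ofFn]; rfl
    rw [hp, hb, ih _ _ (fun i j => ha _ _), Finset.mul_sum]
    refine Finset.sum_congr rfl fun e _ => ?_
    rw [Fin.prod_univ_succ]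
    simp [Equiv.Perm.decomposeFin_symm_apply_zero, Equiv.Perm.decomposeFin_symm_apply_succ]

end WickPermanent

section Correlation

/-- The permutations that move only points of `s`. -/
def permsOn {ι : Type*} [Fintype ι] [DecidableEq ι] (s : Finset ι) : Finset (Equiv.Perm ι) :=
  Finset.univ.filter fun σ => ∀ i, i ∉ s → σ i = i

theorem mem_permsOn {ι : Type*} [Fintype ι] [DecidableEq ι] {s : Finset ι} {σ : Equiv.Perm ι} :
    σ ∈ permsOn s ↔ ∀ i, i ∉ s → σ i = i := by
  simp [permsOn]

theorem sum_permsOn {ι : Type*} [Fintype ι] [DecidableEq ι] (s : Finset ι) (M : ι → ι → ℂ) :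
    ∑ σ ∈ permsOn s, ∏ i ∈ s, M i (σ i)
      = ∑ τ : Equiv.Perm {i // i ∈ s}, ∏ i : {i // i ∈ s}, M i (τ i) := by
  rw [Finset.sum_subtype (permsOn s) (p := fun σ => ∀ i, i ∉ s → σ i = i)
    (fun _ => mem_permsOn)]
  refine (Fintype.sum_equiv (Equiv.Perm.subtypeEquivSubtypePerm (· ∈ s)) _ _ fun τ => ?_).symm
  rw [Finset.prod_subtype s (p := (· ∈ s)) (fun _ => Iff.rfl)]
  refine Finset.prod_congr rfl fun i _ => ?_
  rw [Equiv.Perm.subtypeEquivSubtypePerm_apply_of_mem τ i.2]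

variable {H : Type*} [NormedAddCommGroup H] [InnerProductSpace ℂ H] [CompleteSpace H]
  {S : ℝ → H →L[ℂ] H} {n : H →L[ℂ] H} {N : ℕ} {f g : Fin N → H}

theorem IsUnitaryGroup.conj_rankOne (hS : IsUnitaryGroup S) (s : ℝ) (x y : H) :
    S s ∘L InnerProductSpace.rankOne ℂ x y ∘L S (-s)
      = InnerProductSpace.rankOne ℂ (S s x) (S s y) := by
  ext z
  have h : inner ℂ y (S (-s) z) = inner ℂ (S s y) z := by
    have := hS.inner_map_map s 0 y z
    rw [hS.map_zero, zero_sub] at this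
    exact this.symm
  simp [h]

theorem wick_index_word (c : Fin N ⊕ Fin N → Fin N ⊕ Fin N → ℂ)
    (h1 : ∀ i j, c (.inl i) (.inl j) = 0) (h2 : ∀ i j, c (.inr i) (.inr j) = 0)
    (s : Finset (Fin N)) :
    wick c ((s.sort (· ≤ ·)).flatMap fun l => [.inl l, .inr l])
      = ∑ σ ∈ permsOn s, ∏ i ∈ s,
          if i ≤ σ i then c (.inl i) (.inr (σ i)) else c (.inr (σ i)) (.inl i) := by
  set P : Fin N → Fin N → ℂ := fun i j =>
    if i ≤ j then c (.inl i) (.inr j) else c (.inr j) (.inl i) with hP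
  -- the two-point function with the order of the letters built into it
  let c' : Fin N ⊕ Fin N → Fin N ⊕ Fin N → ℂ
    | .inl i, .inr j => P i j
    | .inr j, .inl i => P i j
    | .inl _, .inl _ => 0
    | .inr _, .inr _ => 0
  have hsymm : ∀ x y, c' x y = c' y x := by rintro (x | x) (y | y) <;> rfl
  set L := s.sort (· ≤ ·) with hL
  have hpair : (L.flatMap fun l => [Sum.inl l, Sum.inr l]).Pairwise
      fun x y => c x y = c' x y := by
    rw [List.pairwise_flatMap]
    refine ⟨fun i _ => ?_, ?_⟩
    · simp [c', hP]
    · have hlt : L.Pairwise (· < ·) := (Finset.sortedLT_sort s).pairwise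
      refine hlt.imp fun {i j} hij => ?_
      simp [c', hP, h1, h2, hij.le, hij.not_ge]
  have hperm : (L.flatMap fun l => [Sum.inl l, Sum.inr l]).Perm
      (L.map Sum.inl ++ L.map Sum.inr) := by
    clear hpair hL
    induction L with
    | nil => simp
    | cons x L ih =>
      simp only [List.flatMap_cons, List.map_cons, List.cons_append, List.nil_append]
      refine List.Perm.cons _ ?_
      exact (ih.cons _).trans List.perm_middle.symm
  have hofFn : ∀ F : Fin N → Fin N ⊕ Fin N, L.map F = List.ofFn fun k : Fin L.length => F L[k] := by
    intro F
    apply List.ext_getElem <;> simp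
  rw [wick_congr_of_pairwise _ hpair, wick_perm hsymm hperm, hofFn, hofFn,
    wick_ofFn_append hsymm _ _ (fun _ _ => rfl)]
  change _ = ∑ σ ∈ permsOn s, ∏ i ∈ s, P i (σ i)
  rw [sum_permsOn]
  let e : Fin L.length ≃ {i // i ∈ s} :=
    (List.Nodup.getEquiv L (Finset.sort_nodup _ _)).trans
      (Equiv.subtypeEquivRight fun i => Finset.mem_sort _)
  refine Fintype.sum_equiv e.permCongr _ _ fun σ => ?_
  rw [← e.prod_comp]
  refine Finset.prod_congr rfl fun i _ => ?_
  simp [c', e]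

/-- The correlation functions as sums over permutations. -/
theorem correlation_eq (hS : IsUnitaryGroup S) (ω : Fin N → ℝ) (ε : ℝ) (hε : 0 < ε)
    (t : Fin N → ℝ) (s : Finset (Fin N)) :
    correlation S n (fun l => InnerProductSpace.rankOne ℂ (f l) (g l)) ω ε t s
      = ∑ σ ∈ permsOn s, ∏ i ∈ s,
          Complex.exp (-(Complex.I * t i * ω i / ε)) * pairing S n f g ε t i (σ i) := by
  set z : Fin N → ℂ := fun l => Complex.exp (-(Complex.I * t l * ω l / ε)) / ε with hz
  let F : Fin N ⊕ Fin N → Ladder H :=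
    Sum.elim (fun i => .create (S (t i / ε) (f i))) (fun j => .annihilate (S (t j / ε) (g j)))
  have hword : ∀ L : List (Fin N), (L.map fun l =>
        scaledNumberOp S (InnerProductSpace.rankOne ℂ (f l) (g l)) (ω l) ε (t l)).prod
      = (L.map z).prod •
        (((L.flatMap fun l => [Sum.inl l, Sum.inr l]).map F).map ladderOp).prod := by
    intro L
    induction L with
    | nil => simp
    | cons l L ih =>
      rw [List.map_cons, List.prod_cons, ih, scaledNumberOp, hS.conj_rankOne, numberOp_rankOne]
      simp only [List.flatMap_cons, List.map_append, List.map_cons, List.prod_cons,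
        List.prod_append, List.map_nil, List.prod_nil, mul_one, smul_mul_smul_comm]
      rfl
  have hprod : ((s.sort (· ≤ ·)).map z).prod = ∏ l ∈ s, z l := by
    rw [← List.prod_toFinset z (Finset.sort_nodup _ _), Finset.sort_toFinset]
  rw [correlation, hword, map_smul, gaussianState_prod, wick_map,
    wick_index_word _ (fun _ _ => rfl) (fun _ _ => rfl), hprod, smul_eq_mul, Finset.mul_sum]
  refine Finset.sum_congr rfl fun σ _ => ?_
  rw [← Finset.prod_mul_distrib]
  refine Finset.prod_congr rfl fun i _ => ?_
  have hs : ((Real.sqrt ε : ℂ)⁻¹) * ((Real.sqrt ε : ℂ)⁻¹) = (ε : ℂ)⁻¹ := by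
    rw [← mul_inv, ← Complex.ofReal_mul, Real.mul_self_sqrt hε.le]
  have hpair : pairing S n f g ε t i (σ i) = (ε : ℂ)⁻¹ *
      (if i ≤ σ i then twoPoint ((ε : ℂ) • n) (F (.inl i)) (F (.inr (σ i)))
        else twoPoint ((ε : ℂ) • n) (F (.inr (σ i))) (F (.inl i))) := by
    rw [pairing]
    split_ifs with h
    · simp only [smul_mul_smul_comm, hs, map_smul, gaussianState_creation_mul_annihilation,
        smul_eq_mul]
      rfl
    · simp only [smul_mul_smul_comm, hs, map_smul, gaussianState_annihilation_mul_creation,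
        smul_eq_mul]
      rfl
  rw [hpair, hz]
  simp only
  ring

end Correlation

/-! ### The cluster expansion over irreducible diagrams -/

section Cluster

variable {ι : Type*}

/-- The set `B` has no nonempty proper subset that is invariant under `σ`. The condition depends
only on the values of `σ` on `B`. -/
def IrreducibleOn (σ : Equiv.Perm ι) (B : Finset ι) : Prop :=
  ∀ I ⊆ B, I.Nonempty → (∀ i ∈ B, i ∈ I ↔ σ i ∈ I) → I = B

theorem IrreducibleOn.congr {σ τ : Equiv.Perm ι} {B : Finset ι} (h : IrreducibleOn σ B)
    (hστ : ∀ i ∈ B, σ i = τ i) : IrreducibleOn τ B :=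
  fun I hI hne hinv => h I hI hne fun i hi => by rw [hστ i hi]; exact hinv i hi

theorem mem_of_sameCycle {σ : Equiv.Perm ι} {B : Finset ι} (hB : ∀ i, i ∈ B ↔ σ i ∈ B)
    {i j : ι} (h : σ.SameCycle i j) (hi : i ∈ B) : j ∈ B := by
  obtain ⟨k, rfl⟩ := h
  have := ((σ.subtypePerm (p := (· ∈ B)) (fun x => (hB x).symm) ^ k) ⟨i, hi⟩).2
  rwa [Equiv.Perm.subtypePerm_zpow] at this

theorem IrreducibleOn.sameCycle_iff {σ : Equiv.Perm ι} {B : Finset ι} (h : IrreducibleOn σ B)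
    (hB : ∀ i, i ∈ B ↔ σ i ∈ B) {i : ι} (hi : i ∈ B) (j : ι) : σ.SameCycle i j ↔ j ∈ B := by
  classical
  refine ⟨fun hij => mem_of_sameCycle hB hij hi, fun hj => ?_⟩
  have := h (B.filter fun k => σ.SameCycle i k) (Finset.filter_subset _ _)
    ⟨i, Finset.mem_filter.2 ⟨hi, Equiv.Perm.SameCycle.refl _ _⟩⟩ fun k hk => by
      simp [hk, (hB k).1 hk]
  rw [← this] at hj
  exact (Finset.mem_filter.1 hj).2

variable [DecidableEq ι]

theorem irreducibleOn_of_sameCycle {σ : Equiv.Perm ι} {B : Finset ι}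
    (hB : ∀ i, i ∈ B ↔ σ i ∈ B) (h : ∀ i ∈ B, ∀ j ∈ B, σ.SameCycle i j) : IrreducibleOn σ B := by
  rintro I hI ⟨i, hi⟩ hinv
  refine Finset.Subset.antisymm hI fun j hj => mem_of_sameCycle (B := I) (fun k => ?_)
    (h i (hI hi) j hj) hi
  by_cases hk : k ∈ B
  · exact hinv k hk
  · exact iff_of_false (fun h' => hk (hI h')) fun h' => hk ((hB k).2 (hI h'))

theorem finpartition_ext_of_part {s : Finset ι} {π π' : Finpartition s}
    (h : ∀ i ∈ s, π.part i = π'.part i) : π = π' := by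
  have key : ∀ P : Finpartition s, P.parts = s.image P.part := fun P => by
    ext B
    rw [Finset.mem_image]
    constructor
    · intro hB
      obtain ⟨i, hi⟩ := P.nonempty_of_mem_parts hB
      exact ⟨i, P.le hB hi, P.part_eq_of_mem hB hi⟩
    · rintro ⟨i, hi, rfl⟩
      exact P.part_mem.2 hi
  refine Finpartition.ext ?_
  rw [key, key]
  exact Finset.image_congr fun i hi => h i hi

/-- The partition of `s` into the orbits of `σ`. -/
noncomputable def orbitPartition (σ : Equiv.Perm ι) (s : Finset ι) : Finpartition s :=
  open Classical in Finpartition.ofSetSetoid (Equiv.Perm.SameCycle.setoid σ) s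

theorem mem_part_orbitPartition {σ : Equiv.Perm ι} {s : Finset ι} {i j : ι} (hi : i ∈ s) :
    j ∈ (orbitPartition σ s).part i ↔ j ∈ s ∧ σ.SameCycle i j := by
  classical
  rw [orbitPartition, Finpartition.mem_part_ofSetSetoid_iff_rel]
  exact ⟨fun h => h.2, fun h => ⟨hi, h⟩⟩

variable {s : Finset ι} (π : Finpartition s)

/-- The function that acts on every block `B` of the partition like `h B`. -/
def glueFun (h : {B // B ∈ π.parts} → Equiv.Perm ι) (i : ι) : ι :=
  if hi : i ∈ s then h ⟨π.part i, π.part_mem.2 hi⟩ i else i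

theorem glueFun_of_mem (h : {B // B ∈ π.parts} → Equiv.Perm ι) (B : {B // B ∈ π.parts}) {i : ι}
    (hi : i ∈ B.1) : glueFun π h i = h B i := by
  have e : (⟨π.part i, π.part_mem.2 (π.le B.2 hi)⟩ : {B // B ∈ π.parts}) = B :=
    Subtype.ext (π.part_eq_of_mem B.2 hi)
  rw [glueFun, dif_pos (π.le B.2 hi), e]

theorem glueFun_of_notMem (h : {B // B ∈ π.parts} → Equiv.Perm ι) {i : ι} (hi : i ∉ s) :
    glueFun π h i = i := by
  rw [glueFun, dif_neg hi]

theorem exists_block {i : ι} (hi : i ∈ s) : ∃ B : {B // B ∈ π.parts}, i ∈ B.1 :=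
  ⟨⟨π.part i, π.part_mem.2 hi⟩, π.mem_part hi⟩

variable [Fintype ι]

theorem mem_iff_of_mem_permsOn {σ : Equiv.Perm ι} {s : Finset ι} (hσ : σ ∈ permsOn s) (i : ι) :
    i ∈ s ↔ σ i ∈ s := by
  have h := mem_permsOn.1 hσ
  refine ⟨fun hi => ?_, fun hi => ?_⟩
  · by_contra hn
    rw [σ.injective (h _ hn)] at hn
    exact hn hi
  · by_contra hn
    rw [h i hn] at hi
    exact hn hi

open Classical in
/-- The permutations of the set `B` without nonempty proper invariant subsets. -/
noncomputable def irreduciblesOn (B : Finset ι) : Finset (Equiv.Perm ι) :=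
  (permsOn B).filter fun σ => IrreducibleOn σ B

theorem mem_irreduciblesOn {σ : Equiv.Perm ι} {B : Finset ι} :
    σ ∈ irreduciblesOn B ↔ σ ∈ permsOn B ∧ IrreducibleOn σ B := by
  simp [irreduciblesOn]

variable (h : {B // B ∈ π.parts} → Equiv.Perm ι)

theorem glueFun_mem (hh : ∀ B : {B // B ∈ π.parts}, h B ∈ permsOn B.1) (B : {B // B ∈ π.parts}) {i : ι}
    (hi : i ∈ B.1) : glueFun π h i ∈ B.1 := by
  rw [glueFun_of_mem π h B hi]
  exact (mem_iff_of_mem_permsOn (hh B) i).1 hi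

theorem glueFun_injective (hh : ∀ B : {B // B ∈ π.parts}, h B ∈ permsOn B.1) : Function.Injective (glueFun π h) := by
  have hs : ∀ i, i ∈ s → glueFun π h i ∈ s := fun i hi => by
    obtain ⟨B, hB⟩ := exists_block π hi
    exact π.le B.2 (glueFun_mem π h hh B hB)
  intro i j hij
  by_cases hi : i ∈ s <;> by_cases hj : j ∈ s
  · obtain ⟨B, hB⟩ := exists_block π hi
    obtain ⟨C, hC⟩ := exists_block π hj
    have hBC : B = C := Subtype.ext (π.eq_of_mem_parts B.2 C.2 (glueFun_mem π h hh B hB)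
      (hij ▸ glueFun_mem π h hh C hC))
    subst hBC
    rw [glueFun_of_mem π h B hB, glueFun_of_mem π h B hC] at hij
    exact (h B).injective hij
  · have := hs i hi
    rw [hij, glueFun_of_notMem π h hj] at this
    exact absurd this hj
  · have := hs j hj
    rw [← hij, glueFun_of_notMem π h hi] at this
    exact absurd this hi
  · rwa [glueFun_of_notMem π h hi, glueFun_of_notMem π h hj] at hij

/-- The permutation of `s` composed of permutations of the blocks of a partition of `s`. -/
noncomputable def glue (hh : ∀ B : {B // B ∈ π.parts}, h B ∈ permsOn B.1) : Equiv.Perm ι :=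
  Equiv.ofBijective _ (Finite.injective_iff_bijective.1 (glueFun_injective π h hh))

theorem glue_apply (hh : ∀ B : {B // B ∈ π.parts}, h B ∈ permsOn B.1) (i : ι) : glue π h hh i = glueFun π h i := rfl

theorem glue_mem_permsOn (hh : ∀ B : {B // B ∈ π.parts}, h B ∈ permsOn B.1) : glue π h hh ∈ permsOn s :=
  mem_permsOn.2 fun _ hi => glueFun_of_notMem π h hi

theorem mem_block_iff_glue (hh : ∀ B : {B // B ∈ π.parts}, h B ∈ permsOn B.1) (B : {B // B ∈ π.parts}) (i : ι) :
    i ∈ B.1 ↔ glue π h hh i ∈ B.1 := by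
  refine ⟨fun hi => glueFun_mem π h hh B hi, fun hi => ?_⟩
  have his : i ∈ s := (mem_iff_of_mem_permsOn (glue_mem_permsOn π h hh) i).2 (π.le B.2 hi)
  obtain ⟨C, hC⟩ := exists_block π his
  have : C = B := Subtype.ext (π.eq_of_mem_parts C.2 B.2 (glueFun_mem π h hh C hC) hi)
  exact this ▸ hC

/-- If the permutations of the blocks are irreducible, the blocks are the orbits. -/
theorem orbitPartition_glue (hh : ∀ B : {B // B ∈ π.parts}, h B ∈ permsOn B.1)
    (hirr : ∀ B : {B // B ∈ π.parts}, IrreducibleOn (h B) B.1) : orbitPartition (glue π h hh) s = π := by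
  refine finpartition_ext_of_part fun i hi => Finset.ext fun j => ?_
  obtain ⟨B, hB⟩ := exists_block π hi
  have hB' : IrreducibleOn (glue π h hh) B.1 :=
    (hirr B).congr fun k hk => (glueFun_of_mem π h B hk).symm
  rw [mem_part_orbitPartition hi, π.part_eq_of_mem B.2 hB,
    hB'.sameCycle_iff (mem_block_iff_glue π h hh B) hB]
  exact ⟨fun hj => hj.2, fun hj => ⟨π.le B.2 hj, hj⟩⟩

/-- Every permutation of `s` is uniquely composed of irreducible permutations of the blocks of a
partition of `s`, its orbits. -/
theorem sum_permsOn_eq_sum_finpartition (M : ι → ι → ℂ) (s : Finset ι) :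
    ∑ σ ∈ permsOn s, ∏ i ∈ s, M i (σ i)
      = ∑ π : Finpartition s, ∏ B : {B // B ∈ π.parts},
          ∑ σ ∈ irreduciblesOn B.1, ∏ i ∈ B.1, M i (σ i) := by
  classical
  rw [← Finset.sum_fiberwise _ fun σ => orbitPartition σ s]
  refine Finset.sum_congr rfl fun π _ => ?_
  rw [Finset.prod_univ_sum]
  symm
  have hmem : ∀ {h : {B // B ∈ π.parts} → Equiv.Perm ι},
      h ∈ Fintype.piFinset (fun B : {B // B ∈ π.parts} => irreduciblesOn B.1) →
        ∀ B, h B ∈ permsOn B.1 := fun hh B =>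
    (mem_irreduciblesOn.1 (Fintype.mem_piFinset.1 hh B)).1
  refine Finset.sum_bij (fun h hh => glue π h (hmem hh)) ?_ ?_ ?_ ?_
  · intro h hh
    exact Finset.mem_filter.2 ⟨glue_mem_permsOn π h _, orbitPartition_glue π h _ fun B =>
      (mem_irreduciblesOn.1 (Fintype.mem_piFinset.1 hh B)).2⟩
  · intro h hh h' hh' heq
    refine funext fun B => Equiv.ext fun i => ?_
    by_cases hi : i ∈ B.1
    · have := congrArg (fun σ : Equiv.Perm ι => σ i) heq
      simp only [glue_apply] at this
      rwa [glueFun_of_mem π h B hi, glueFun_of_mem π h' B hi] at this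
    · rw [mem_permsOn.1 (hmem hh B) i hi, mem_permsOn.1 (hmem hh' B) i hi]
  · intro σ hσ
    obtain ⟨hσs, hσπ⟩ := Finset.mem_filter.1 hσ
    have hcyc : ∀ B : {B // B ∈ π.parts}, ∀ i ∈ B.1, ∀ j, j ∈ B.1 ↔ j ∈ s ∧ σ.SameCycle i j := by
      intro B i hi j
      rw [← mem_part_orbitPartition (π.le B.2 hi), hσπ, π.part_eq_of_mem B.2 hi]
    have hinv : ∀ B : {B // B ∈ π.parts}, ∀ i, i ∈ B.1 ↔ σ i ∈ B.1 := by
      intro B i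
      constructor
      · intro hi
        rw [hcyc B i hi]
        exact ⟨(mem_iff_of_mem_permsOn hσs i).1 (π.le B.2 hi),
          Equiv.Perm.sameCycle_apply_right.2 (Equiv.Perm.SameCycle.refl _ _)⟩
      · intro hi
        rw [hcyc B _ hi]
        exact ⟨(mem_iff_of_mem_permsOn hσs i).2 (π.le B.2 hi),
          Equiv.Perm.sameCycle_apply_left.2 (Equiv.Perm.SameCycle.refl _ _)⟩
    let h : {B // B ∈ π.parts} → Equiv.Perm ι := fun B =>
      Equiv.Perm.ofSubtype (σ.subtypePerm (p := (· ∈ B.1)) fun i => (hinv B i).symm)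
    have hval : ∀ B : {B // B ∈ π.parts}, ∀ i ∈ B.1, h B i = σ i := fun B i hi => by
      simp only [h]
      rw [Equiv.Perm.ofSubtype_apply_of_mem _ hi]
      rfl
    have hh : h ∈ Fintype.piFinset (fun B : {B // B ∈ π.parts} => irreduciblesOn B.1) := by
      refine Fintype.mem_piFinset.2 fun B => mem_irreduciblesOn.2 ⟨?_, ?_⟩
      · exact mem_permsOn.2 fun i hi => Equiv.Perm.ofSubtype_apply_of_not_mem _ hi
      · refine IrreducibleOn.congr (irreducibleOn_of_sameCycle (hinv B) fun i hi j hj => ?_)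
          fun i hi => (hval B i hi).symm
        exact ((hcyc B i hi j).1 hj).2
    refine ⟨h, hh, Equiv.ext fun i => ?_⟩
    rw [glue_apply]
    by_cases hi : i ∈ s
    · obtain ⟨B, hB⟩ := exists_block π hi
      rw [glueFun_of_mem π h B hB, hval B i hB]
    · rw [glueFun_of_notMem π h hi, mem_permsOn.1 hσs i hi]
  · intro h hh
    have hs : s = Finset.univ.biUnion fun B : {B // B ∈ π.parts} => B.1 := by
      ext i
      rw [Finset.mem_biUnion]
      exact ⟨fun hi => (exists_block π hi).imp fun B hB => ⟨Finset.mem_univ _, hB⟩,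
        fun ⟨B, _, hB⟩ => π.le B.2 hB⟩
    have hprod : ∏ i ∈ s, M i (glue π h (hmem hh) i)
        = ∏ B : {B // B ∈ π.parts}, ∏ i ∈ B.1, M i (glue π h (hmem hh) i) := by
      rw [← Finset.prod_biUnion, ← hs]
      refine fun B _ C _ hBC => ?_
      exact π.disjoint B.2 C.2 fun e => hBC (Subtype.ext e)
    rw [hprod]
    refine Finset.prod_congr rfl fun B _ => Finset.prod_congr rfl fun i hi => ?_
    rw [glue_apply, glueFun_of_mem π h B hi]

end Cluster

section Truncation

variable {N : ℕ}

/-- The recursion for the truncated functions is solved by the connected parts of any cluster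
expansion. -/
theorem truncated_eq {W U : Finset (Fin N) → ℂ}
    (h : ∀ s, W s = ∑ π : Finpartition s, ∏ B : {B // B ∈ π.parts}, U B.1)
    (s : Finset (Fin N)) (hs : s.Nonempty) : truncated W s = U s := by
  induction hn : s.card using Nat.strong_induction_on generalizing s with
  | _ n ih =>
    subst hn
    rw [truncated, h s]
    have hbot : s ≠ ⊥ := hs.ne_empty
    have h1 : ∀ π : Finpartition s, ¬ 2 ≤ π.parts.card ↔ π = Finpartition.indiscrete hbot := by
      intro π
      constructor
      · intro hπ
        obtain ⟨i, hi⟩ := hs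
        have hB := π.part_mem.2 hi
        have hparts : π.parts = {π.part i} := by
          refine Finset.eq_singleton_iff_unique_mem.2 ⟨hB, fun C hC => ?_⟩
          exact Finset.card_le_one.1 (by omega) C hC _ hB
        refine Finpartition.ext ?_
        have hsup := π.sup_parts
        rw [hparts, Finset.sup_singleton, id] at hsup
        rw [hparts, hsup]
        rfl
      · rintro rfl
        simp
    have hsub : ∑ π : {π : Finpartition s // 2 ≤ π.parts.card},
          ∏ B : {B : Finset (Fin N) // B ∈ π.1.parts}, truncated W B.1
        = ∑ π : {π : Finpartition s // 2 ≤ π.parts.card},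
          ∏ B : {B : Finset (Fin N) // B ∈ π.1.parts}, U B.1 := by
      refine Finset.sum_congr rfl fun π _ => Finset.prod_congr rfl fun B _ => ?_
      refine ih _ (Finset.card_lt_card ((π.1.le B.2).ssubset_of_ne fun hB => ?_)) _
        (π.1.nonempty_of_mem_parts B.2) rfl
      obtain ⟨C, hC, hne⟩ := Finset.exists_mem_ne (show 1 < π.1.parts.card from π.2) B.1
      have hd : Disjoint C B.1 := π.1.disjoint hC B.2 hne
      rw [hB] at hd
      exact π.1.ne_bot hC (disjoint_self.1 (hd.mono_right (π.1.le hC)))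
    rw [hsub, ← Fintype.sum_subtype_add_sum_subtype (fun π : Finpartition s => 2 ≤ π.parts.card),
      add_sub_cancel_left]
    let u : {π : Finpartition s // ¬ 2 ≤ π.parts.card} :=
      ⟨Finpartition.indiscrete hbot, (h1 _).2 rfl⟩
    rw [Fintype.sum_eq_single u fun π hπ => absurd (Subtype.ext ((h1 _).1 π.2)) hπ]
    exact Fintype.prod_eq_single (⟨s, Finset.mem_singleton_self s⟩ :
      {B // B ∈ (Finpartition.indiscrete hbot).parts}) fun B hB =>
        absurd (Subtype.ext (Finset.mem_singleton.1 B.2)) hB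

end Truncation

/-! ### The truncated correlation functions -/

section TruncatedCorrelation

variable {H : Type*} [NormedAddCommGroup H] [InnerProductSpace ℂ H] [CompleteSpace H]
  {S : ℝ → H →L[ℂ] H} {n : H →L[ℂ] H} {N : ℕ} {f g : Fin N → H}

theorem mem_irreduciblesOn_univ (σ : Equiv.Perm (Fin N)) :
    σ ∈ irreduciblesOn Finset.univ ↔ IsIrreducibleDiagram σ := by
  rw [mem_irreduciblesOn, mem_permsOn]
  constructor
  · rintro ⟨_, hirr⟩ ⟨I, hne, hI, hinv⟩
    exact hI (hirr I (Finset.subset_univ _) hne fun i _ => hinv i)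
  · refine fun h => ⟨fun i hi => absurd (Finset.mem_univ i) hi, ?_⟩
    intro I _ hne hinv
    by_contra hI
    exact h ⟨I, hne, hI, fun i => hinv i (Finset.mem_univ i)⟩

/-- The truncated correlation function is the sum of the irreducible diagrams. -/
theorem truncatedCorrelation_eq_sum (hS : IsUnitaryGroup S) (ω : Fin (N + 1) → ℝ)
    {f g : Fin (N + 1) → H} {ε : ℝ} (hε : 0 < ε) (t : Fin (N + 1) → ℝ) :
    truncatedCorrelation S n (fun l => InnerProductSpace.rankOne ℂ (f l) (g l)) ω ε t
      = ∑ σ ∈ irreduciblesOn Finset.univ, diagram S n f g ω ε t σ := by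
  rw [truncatedCorrelation, truncated_eq (U := fun B => ∑ σ ∈ irreduciblesOn B, ∏ i ∈ B,
    Complex.exp (-(Complex.I * t i * ω i / ε)) * pairing S n f g ε t i (σ i))
    (fun s => by rw [correlation_eq hS ω ε hε, sum_permsOn_eq_sum_finpartition
      (fun i j => Complex.exp (-(Complex.I * t i * ω i / ε)) * pairing S n f g ε t i j)])
    _ Finset.univ_nonempty]
  refine Finset.sum_congr rfl fun σ _ => ?_
  rw [diagram, Finset.prod_mul_distrib, ← Complex.exp_sum, Finset.mul_sum,
    ← Finset.sum_neg_distrib]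
  congr 2
  exact Finset.sum_congr rfl fun l _ => by ring

end TruncatedCorrelation

end LowDensity

theorem theorem2
    {H : Type*} [NormedAddCommGroup H] [InnerProductSpace ℂ H] [CompleteSpace H]
    (S : ℝ → H →L[ℂ] H) (hS : LowDensity.IsUnitaryGroup S)
    (n : H →L[ℂ] H) (hn : n.IsPositive) (hSn : ∀ t, S (-t) ∘L n ∘L S t = n)
    -- the number of operators is `m + 1`
    (m : ℕ) (f g : Fin (m + 1) → H) (ω : Fin (m + 1) → ℝ)
    -- `p j i` is the function `E ↦ ⟨g_j, P_E f_i⟩` and `q j i` is `E ↦ ⟨g_j, P_E n f_i⟩`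
    (p q : Fin (m + 1) → Fin (m + 1) → ℝ → ℂ)
    (hp : ∀ j i, j < i → LowDensity.IsEnergyDensity S (g j) (f i) (p j i) ∧
      MemLp (p j i) ((m + 1 : ℕ) : ENNReal) volume)
    (hq : ∀ j i, LowDensity.IsEnergyDensity S (g j) (n (f i)) (q j i) ∧
      MemLp (q j i) ((m + 1 : ℕ) : ENNReal) volume) :
    let T : Fin (m + 1) → H →L[ℂ] H := fun l => InnerProductSpace.rankOne ℂ (f l) (g l)
    let ωt : Fin (m + 1) → ℝ := fun k => ∑ l ∈ Finset.Ici k, ω l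
    let F : ℝ → ℂ := fun E =>
      q (Fin.last m) 0 E * ∏ l : Fin m, p l.castSucc l.succ (E + ωt l.succ)
    -- the limiting distribution; `δ(t₂ - t₁) ⋯ δ(tₙ - tₙ₋₁)` maps `φ` to `∫ φ(t, …, t) dt`
    let limit : 𝓢(Fin (m + 1) → ℝ, ℂ) → ℂ := fun φ =>
      (2 * Real.pi : ℂ) ^ m * (if ωt 0 = 0 then 1 else 0) * (∫ E, F E) *
        ∫ t : ℝ, φ (fun _ => t)
    Integrable F ∧
    -- the low density limit of the truncated correlation function
    (∀ φ : 𝓢(Fin (m + 1) → ℝ, ℂ),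
      Tendsto (fun ε : ℝ => ∫ t, LowDensity.truncatedCorrelation S n T ω ε t * φ t)
        (𝓝[>] 0) (𝓝 (limit φ))) ∧
    -- the truncated correlation function is the sum of the irreducible diagrams
    (∀ ε : ℝ, 0 < ε → ∀ t, LowDensity.truncatedCorrelation S n T ω ε t =
      ∑ᶠ σ ∈ {σ | LowDensity.IsIrreducibleDiagram σ}, LowDensity.diagram S n f g ω ε t σ) ∧
    -- the only irreducible non-crossing diagram is the stated one
    (∀ σ : Equiv.Perm (Fin (m + 1)),
      (LowDensity.IsIrreducibleDiagram σ ∧ LowDensity.IsNonCrossingDiagram σ) ↔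
        σ = LowDensity.outerDiagram (m + 1)) ∧
    -- it carries the whole limit
    (∀ φ : 𝓢(Fin (m + 1) → ℝ, ℂ),
      Tendsto (fun ε : ℝ => ∫ t,
          LowDensity.diagram S n f g ω ε t (LowDensity.outerDiagram (m + 1)) * φ t)
        (𝓝[>] 0) (𝓝 (limit φ))) ∧
    -- all other irreducible diagrams vanish in the limit
    (∀ σ : Equiv.Perm (Fin (m + 1)), LowDensity.IsIrreducibleDiagram σ →
      σ ≠ LowDensity.outerDiagram (m + 1) →
      ∀ φ : 𝓢(Fin (m + 1) → ℝ, ℂ),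
        Tendsto (fun ε : ℝ => ∫ t, LowDensity.diagram S n f g ω ε t σ * φ t)
          (𝓝[>] 0) (𝓝 0)) := by 
  intro T ωt F limit
  have hpq : LowDensity.HasEnergyDensities S n f g p q := ⟨hp, hq⟩
  have houter : ∀ φ : 𝓢(Fin (m + 1) → ℝ, ℂ),
      Tendsto (fun ε : ℝ => ∫ t,
          LowDensity.diagram S n f g ω ε t (LowDensity.outerDiagram (m + 1)) * φ t)
        (𝓝[>] 0) (𝓝 (limit φ)) :=
    fun φ => LowDensity.tendsto_diagram_outerDiagram hS hSn hpq ω φ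
  have hother : ∀ σ : Equiv.Perm (Fin (m + 1)), LowDensity.IsIrreducibleDiagram σ →
      σ ≠ LowDensity.outerDiagram (m + 1) → ∀ φ : 𝓢(Fin (m + 1) → ℝ, ℂ),
        Tendsto (fun ε : ℝ => ∫ t, LowDensity.diagram S n f g ω ε t σ * φ t)
          (𝓝[>] 0) (𝓝 0) :=
    fun σ hσ hne φ => LowDensity.tendsto_diagram_zero hS hSn hpq ω hσ hne φ
  refine ⟨LowDensity.integrable_limit_density hpq _, fun φ => ?_, fun ε hε t => ?_,
    LowDensity.isIrreducible_and_isNonCrossing_iff, houter, hother⟩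
  · have h := tendsto_finsetSum (LowDensity.irreduciblesOn Finset.univ)
      (a := fun σ => if σ = LowDensity.outerDiagram (m + 1) then limit φ else 0)
      (f := fun σ (ε : ℝ) => ∫ t, LowDensity.diagram S n f g ω ε t σ * φ t)
      (x := 𝓝[>] 0) fun σ hσ => by
        by_cases hσ' : σ = LowDensity.outerDiagram (m + 1)
        · simp only [hσ', if_true]
          exact houter φ
        · simp only [if_neg hσ']
          exact hother σ ((LowDensity.mem_irreduciblesOn_univ σ).1 hσ) hσ' φ
    rw [Finset.sum_ite_eq', if_pos ((LowDensity.mem_irreduciblesOn_univ _).2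
      LowDensity.isIrreducibleDiagram_outerDiagram)] at h
    refine h.congr' ?_
    filter_upwards [self_mem_nhdsWithin] with ε hε
    rw [← integral_finsetSum _ fun σ _ =>
      LowDensity.integrable_diagram_mul hS hSn hpq ω hε σ φ]
    refine integral_congr_ae (ae_of_all _ fun t => ?_)
    simp only [T]
    rw [LowDensity.truncatedCorrelation_eq_sum hS ω hε, Finset.sum_mul]
  · rw [LowDensity.truncatedCorrelation_eq_sum hS ω hε]
    refine (finsum_mem_eq_sum_of_inter_support_eq _ ?_).symm
    congr 1
    ext σ
    exact (LowDensity.mem_irreduciblesOn_univ σ).symm
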